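/- Let $G$ be a finite abelian group with $|G|=N$, with dual group $\widehat G=\{\chi:G\to\mathbb T\}$, where $\mathbb T$ is the unit circle, and let $F_G=(\chi(i))_{i\in G,\chi\in\widehat G}$ be its Fourier matrix. Let $$E=\sum_{i\in G,\ \chi\in\widehat G}a_i\,b_\chi\,\chi(i)$$ be the associated excess, where the phases $a_i,b_\chi\in\mathbb T$ are independent and uniformly distributed, i.e. $(a,b)$ is distributed according to the Haar probability measure on $\mathbb T^G\times\mathbb T^{\widehat G}\cong\mathbb T^N\times\mathbb T^N$. The law of $E$ is called the glow of $F_G$. (1) For every integer $p\ge 0$, $$\frac1{p!}\int_{\mathbb T^N\times\mathbb T^N}\left(\frac{|E|}{N}\right)^{2p}=1-K_1N^{-1}+K_2N^{-2}-K_3N^{-3}+O(N^{-4}),$$ where $$K_1=\binom p2,\qquad K_2=\binom p2\,\frac{3p^2+p-8}{12},\qquad K_3=\binom p3\,\frac{p^3+4p^2+p-18}{8},$$ and where the constant in $O(N^{-4})$ depends only on $p$, not on $G$. (2) (Universality up to order 3.) For every $p\ge0$ there is a constant $C_p$ such that, for any two finite abelian groups $G,G'$ of the same order $N$, the quantities on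 the left in (1) for $G$ and for $G'$ differ by at most $C_pN^{-4}$. (3) The rescaled glow is asymptotically complex Gaussian: if $(G_n)$ is a sequence of finite abelian groups with $N_n=|G_n|\to\infty$, and $E_n$ is the excess of $F_{G_n}$, then $E_n/N_n$ converges in distribution, and in all moments $\int z^k\bar z^l$ with $k,l\ge 0$, to the complex Gaussian law $\mathcal C$, the law of $\frac1{\sqrt2}(x+iy)$ with $x,y$ independent standard real Gaussian variables. -/

import Mathlib

open MeasureTheory ProbabilityTheory Filter
open scoped Topology

namespace FourierGlow

noncomputable instance instMeasurableSpaceCircle : MeasurableSpace Circle := borel Circle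

instance instBorelSpaceCircle : BorelSpace Circle := ⟨rfl⟩

/-- The uniform probability measure on the unit circle `𝕋`: its Haar measure of total mass one. -/
noncomputable def uniformCircle : Measure Circle :=
  Measure.haarMeasure (⊤ : TopologicalSpace.PositiveCompacts Circle)

instance instIsProbabilityMeasureUniformCircle : IsProbabilityMeasure uniformCircle :=
  ⟨by simpa [uniformCircle] using
    Measure.haarMeasure_self (K₀ := (⊤ : TopologicalSpace.PositiveCompacts Circle))⟩

/-- The uniform probability measure on the torus `𝕋^ι × 𝕋^κ`: all the phases `a i`, `b j` are
independent and uniform on the circle. -/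
noncomputable def uniformPhases (ι κ : Type*) [Fintype ι] [Fintype κ] :
    Measure ((ι → Circle) × (κ → Circle)) :=
  (Measure.pi fun _ : ι => uniformCircle).prod (Measure.pi fun _ : κ => uniformCircle)

instance instIsProbabilityMeasureUniformPhases (ι κ : Type*) [Fintype ι] [Fintype κ] :
    IsProbabilityMeasure (uniformPhases ι κ) := by
  unfold uniformPhases; infer_instance

/-- The excess `E = ∑ a_i b_j H_ij` of `H`, as a function of the phases `(a, b)`. The law of this
random variable under `uniformPhases` is the glow of `H`. -/
noncomputable def excess {ι κ : Type*} [Fintype ι] [Fintype κ] (H : Matrix ι κ ℂ)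
    (ab : (ι → Circle) × (κ → Circle)) : ℂ :=
  ∑ i, ∑ j, (ab.1 i : ℂ) * (ab.2 j : ℂ) * H i j

/-- The Fourier matrix `F_G` of a finite abelian group `G`: the matrix `(F_G)_{i,χ} = χ(i)`, with
rows indexed by the elements of `G` and columns indexed by the characters of `G`. -/
noncomputable def fourierMatrix (G : Type*) [AddCommGroup G] : Matrix G (AddChar G ℂ) ℂ :=
  Matrix.of fun i χ => χ i

/-- The normalized excess `E / N` of the Fourier matrix of `G`, with `N = |G|`. -/
noncomputable def rescaledExcess (G : Type*) [AddCommGroup G] [Fintype G]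
    (ab : (G → Circle) × (AddChar G ℂ → Circle)) : ℂ :=
  excess (fourierMatrix G) ab / (Fintype.card G : ℂ)

/-- The moment `∫ (|E| / N)^{2p}` of the rescaled glow of the Fourier matrix of `G`. -/
noncomputable def glowMoment (G : Type*) [AddCommGroup G] [Fintype G] (p : ℕ) : ℝ :=
  ∫ ab, ‖rescaledExcess G ab‖ ^ (2 * p) ∂(uniformPhases G (AddChar G ℂ))

/-- The complex Gaussian law: the law of `(x + i y) / √2`, where `x`, `y` are independent standard
real Gaussian variables. -/
noncomputable def complexGaussian : Measure ℂ :=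
  ((gaussianReal 0 1).prod (gaussianReal 0 1)).map
    fun xy : ℝ × ℝ => ((xy.1 : ℂ) + Complex.I * (xy.2 : ℂ)) / (Real.sqrt 2 : ℂ)

instance instIsProbabilityMeasureComplexGaussian : IsProbabilityMeasure complexGaussian :=
  Measure.isProbabilityMeasure_map (by fun_prop)

end FourierGlow

namespace FourierGlow

/-! ### Orthogonality of characters of the torus -/

/-! Condition on `a`. Then `E / N` is a linear combination of the independent phases `b χ`, with
coefficients `fourierSum a χ / N`. By orthogonality of the characters of the torus, all its
unbalanced moments vanish, and its `2p`-th absolute moment is `p!²` times a coefficient of a product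
of rescaled copies of `I(t) = ∑ tⁿ / n!²` (`integral_sum_pow_mul_conj_pow`). In terms of the
spectral weights `x_χ = |∑ aᵢ χ(i)|² / N`, whose mean is one by Parseval, this moment is `p!` times
`seriesMoment`. So everything reduces to averaging `seriesMoment (spectralWeight a) p` over `a`.

The logarithmic derivative of `∏ I(x_χ t)` turns products into power sums. It gives a recursion for
`seriesMoment` in `ε = 1/N` and the power means `y n` of the weights (`seriesMoment_succ`), which is
solved modulo `ε⁴` by an explicit polynomial in `y 2`, `y 3`, `y 4`
(`exists_abs_sub_truncatedExpansion_le`). The error is at most a constant times `ε⁴ * y p`, and `y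
p` has average at most `p!`, uniformly in the group.

It remains to average over `a`, to the precision each power of `ε` demands. A single power mean has
an exact average depending only on `N`, because characters are unimodular. At order `ε³` only the
limits of the averages matter; there the weights at distinct characters behave like independent
exponential variables (`exists_abs_integral_prod_powerMean_sub_le`). The delicate term is the
average of `y 2 ^ 2`, needed up to `O(ε²)`. Since `N² y 2` is a sum over additive quadruples `i + j
= k + l`, its variance can be counted, and its leading part cancels the `ε` term of the squared mean
(`abs_integral_sq_powerMean_two_sub_le`).

For the Gaussian limit, `seriesMoment` lies in `[0, 1]` and its average tends to one. This gives the
moments at once, and dominated convergence in the power series of the characteristic function gives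
convergence in law. -/

/-- The law of independent uniform phases indexed by `ι`. -/
noncomputable abbrev torusMeasure (ι : Type*) [Fintype ι] : Measure (ι → Circle) :=
  Measure.pi fun _ => uniformCircle

instance instIsMulLeftInvariantUniformCircle : uniformCircle.IsMulLeftInvariant := by
  unfold uniformCircle; infer_instance

theorem integrable_of_continuous {X E : Type*} [TopologicalSpace X] [CompactSpace X]
    [MeasurableSpace X] [OpensMeasurableSpace X] [NormedAddCommGroup E]
    [SecondCountableTopologyEither X E] {μ : Measure X} [IsFiniteMeasure μ] {f : X → E}
    (hf : Continuous f) : Integrable f μ := by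
  obtain ⟨C, hC⟩ := isCompact_univ.exists_bound_of_continuousOn hf.continuousOn
  exact Integrable.of_bound hf.aestronglyMeasurable C (ae_of_all _ fun x => hC x trivial)

/-- Rotating by such a `w` changes the sign of an integrand of weight `m`, so its integral against a
rotation-invariant measure vanishes. This serves both the torus and the complex Gaussian. -/
theorem exists_circle_zpow_eq_neg_one {m : ℤ} (hm : m ≠ 0) : ∃ w : Circle, (w : ℂ) ^ m = -1 := by
  have hm' : (m : ℂ) ≠ 0 := by exact_mod_cast hm
  refine ⟨Circle.exp (Real.pi / m), ?_⟩
  rw [Circle.coe_exp, ← Complex.exp_int_mul, ← Complex.exp_pi_mul_I]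
  congr 1
  push_cast
  field_simp

theorem integral_circle_zpow (m : ℤ) :
    ∫ z : Circle, (z : ℂ) ^ m ∂uniformCircle = if m = 0 then 1 else 0 := by
  split_ifs with hm
  · simp [hm]
  · obtain ⟨w, hw⟩ := exists_circle_zpow_eq_neg_one hm
    have h := integral_mul_left_eq_self (μ := uniformCircle) (fun z : Circle => (z : ℂ) ^ m) w
    simp only [Circle.coe_mul, mul_zpow, hw, neg_mul, one_mul, integral_neg] at h
    exact self_eq_neg.mp h.symm

theorem integral_prod_zpow {ι : Type*} [Fintype ι] (m : ι → ℤ) :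
    ∫ a, ∏ i, (a i : ℂ) ^ m i ∂torusMeasure ι = if m = 0 then 1 else 0 := by
  rw [integral_fintype_prod_eq_prod (f := fun i (z : Circle) => (z : ℂ) ^ m i)]
  simp only [integral_circle_zpow, Finset.prod_ite_zero, funext_iff, Finset.mem_univ, true_imp_iff,
    Pi.zero_apply, Finset.prod_const_one]

theorem circle_mul_conj (z : Circle) : (z : ℂ) * (starRingEnd ℂ) (z : ℂ) = 1 := by
  rw [Complex.mul_conj, Circle.normSq_coe]; simp

theorem circle_pow_mul_conj_pow (z : Circle) (m n : ℕ) :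
    (z : ℂ) ^ m * (starRingEnd ℂ) (z : ℂ) ^ n = (z : ℂ) ^ ((m : ℤ) - n) := by
  rw [zpow_sub₀ z.coe_ne_zero, ← Circle.coe_inv_eq_conj, Circle.coe_inv, inv_pow, zpow_natCast,
    zpow_natCast, div_eq_mul_inv]

theorem exists_perm_comp_iff_card_fiber {κ ι : Type*} [Fintype κ] [DecidableEq ι] (f g : κ → ι) :
    (∃ σ : Equiv.Perm κ, g = f ∘ σ) ↔
      ∀ i, (Finset.univ.filter fun k => f k = i).card
        = (Finset.univ.filter fun k => g k = i).card := by
  constructor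
  · rintro ⟨σ, rfl⟩ i
    symm
    refine Finset.card_bij (fun k _ => σ k) (by simp) (fun _ _ _ _ h => σ.injective h) ?_
    intro k hk
    exact ⟨σ.symm k, by simpa using hk, by simp⟩
  · intro h
    have e : ∀ i, Nonempty ({k // g k = i} ≃ {k // f k = i}) := fun i => by
      rw [← Fintype.card_eq, Fintype.card_subtype, Fintype.card_subtype, h]
    refine ⟨Equiv.ofFiberEquiv fun i => (e i).some, funext fun k => ?_⟩
    exact (Equiv.ofFiberEquiv_map _ k).symm

/-- The exponent of `a i` is the difference of the fibre sizes of `f` and `g` over `i`. All these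
vanish exactly when the two tuples are rearrangements of each other. -/
theorem integral_prod_mul_conj {κ ι : Type*} [Fintype κ] [Fintype ι] (f g : κ → ι)
    [Decidable (∃ σ : Equiv.Perm κ, g = f ∘ σ)] :
    ∫ a, ∏ k, ((a (f k) : ℂ) * (starRingEnd ℂ) (a (g k) : ℂ)) ∂torusMeasure ι
      = if ∃ σ : Equiv.Perm κ, g = f ∘ σ then 1 else 0 := by
  classical
  have key : ∀ a : ι → Circle, ∏ k, ((a (f k) : ℂ) * (starRingEnd ℂ) (a (g k) : ℂ))
      = ∏ i, (a i : ℂ) ^ (((Finset.univ.filter fun k => f k = i).card : ℤ)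
        - (Finset.univ.filter fun k => g k = i).card) := by
    intro a
    simp_rw [← circle_pow_mul_conj_pow]
    rw [Finset.prod_mul_distrib, Finset.prod_mul_distrib,
      ← Finset.prod_fiberwise' Finset.univ f fun i => (a i : ℂ),
      ← Finset.prod_fiberwise' Finset.univ g fun i => (starRingEnd ℂ) (a i : ℂ)]
    simp only [Finset.prod_const]
  simp_rw [key, integral_prod_zpow, exists_perm_comp_iff_card_fiber, funext_iff, Pi.zero_apply,
    sub_eq_zero, Nat.cast_inj]

/-! ### The generating series of the conditional moments -/

section Series

open PowerSeries

/-- The series `∑ tⁿ / n!²`. -/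
noncomputable def besselSeries : PowerSeries ℝ := PowerSeries.mk fun n => ((n.factorial : ℝ) ^ 2)⁻¹

/-- The logarithmic derivative of `besselSeries`. -/
noncomputable def besselLogDeriv : PowerSeries ℝ := derivative ℝ besselSeries * besselSeries⁻¹

theorem constantCoeff_besselSeries : constantCoeff besselSeries = 1 := by
  simp [besselSeries, ← coeff_zero_eq_constantCoeff_apply]

theorem besselSeries_mul_logDeriv : besselSeries * besselLogDeriv = derivative ℝ besselSeries := by
  rw [besselLogDeriv, mul_left_comm, PowerSeries.mul_inv_cancel _ (by
    rw [constantCoeff_besselSeries]; exact one_ne_zero), mul_one]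

/-- Comparing coefficients in `I * L = I'` gives a triangular system, from which the first four
coefficients of `L` are read off. -/
theorem sum_coeff_besselLogDeriv (n : ℕ) :
    ∑ p ∈ Finset.HasAntidiagonal.antidiagonal n, ((p.1.factorial : ℝ) ^ 2)⁻¹ * coeff p.2 besselLogDeriv
      = (((n + 1).factorial : ℝ) ^ 2)⁻¹ * (n + 1) := by
  have := congrArg (coeff n) besselSeries_mul_logDeriv
  rw [coeff_mul, coeff_derivative] at this
  simpa [besselSeries] using this

theorem coeff_besselLogDeriv_zero : coeff 0 besselLogDeriv = 1 := by
  have := sum_coeff_besselLogDeriv 0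
  simpa using this

theorem coeff_besselLogDeriv_one : coeff 1 besselLogDeriv = -1 / 2 := by
  have := sum_coeff_besselLogDeriv 1
  simp [Finset.Nat.antidiagonal_succ, coeff_besselLogDeriv_zero, -coeff_zero_eq_constantCoeff,
    Nat.factorial] at this
  linarith

theorem coeff_besselLogDeriv_two : coeff 2 besselLogDeriv = 1 / 3 := by
  have := sum_coeff_besselLogDeriv 2
  simp [Finset.Nat.antidiagonal_succ, coeff_besselLogDeriv_zero, -coeff_zero_eq_constantCoeff,
    coeff_besselLogDeriv_one, Nat.factorial] at this
  linarith

theorem coeff_besselLogDeriv_three : coeff 3 besselLogDeriv = -11 / 48 := by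
  have := sum_coeff_besselLogDeriv 3
  simp [Finset.Nat.antidiagonal_succ, coeff_besselLogDeriv_zero, -coeff_zero_eq_constantCoeff,
    coeff_besselLogDeriv_one, coeff_besselLogDeriv_two, Nat.factorial] at this
  linarith

theorem derivative_rescale (c : ℝ) (f : PowerSeries ℝ) :
    derivative ℝ (rescale c f) = C c * rescale c (derivative ℝ f) := by
  ext n
  simp only [coeff_derivative, coeff_rescale, coeff_C_mul]
  ring

theorem coeff_prod_nonneg_le {ι : Type*} {s : Finset ι} {f g : ι → PowerSeries ℝ}
    (h : ∀ i ∈ s, ∀ n, 0 ≤ coeff n (f i) ∧ coeff n (f i) ≤ coeff n (g i)) (n : ℕ) :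
    0 ≤ coeff n (∏ i ∈ s, f i) ∧ coeff n (∏ i ∈ s, f i) ≤ coeff n (∏ i ∈ s, g i) := by
  classical
  rw [coeff_prod, coeff_prod]
  exact ⟨Finset.sum_nonneg fun l _ => Finset.prod_nonneg fun i hi => (h i hi _).1,
    Finset.sum_le_sum fun l _ => Finset.prod_le_prod (fun i hi => (h i hi _).1)
      fun i hi => (h i hi _).2⟩

theorem prod_rescale_exp {ι : Type*} (s : Finset ι) (x : ι → ℝ) :
    ∏ i ∈ s, rescale (x i) (PowerSeries.exp ℝ) = rescale (∑ i ∈ s, x i) (PowerSeries.exp ℝ) := by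
  classical
  induction s using Finset.induction_on with
  | empty => ext n; simp [coeff_one]
  | insert i s hi ih =>
    rw [Finset.prod_insert hi, Finset.sum_insert hi, ih, exp_mul_exp_eq_exp_add]

/-! ### Products of rescaled series and power means of a finite family -/

section Family

variable {ι : Type*} [Fintype ι]

/-- The series `∏ I(xᵢ t)`, where `I` is `besselSeries`. -/
noncomputable def familySeries (x : ι → ℝ) : PowerSeries ℝ := ∏ i, rescale (x i) besselSeries

theorem derivative_familySeries (x : ι → ℝ) :
    derivative ℝ (familySeries x)
      = familySeries x * ∑ i, C (x i) * rescale (x i) besselLogDeriv := by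
  classical
  unfold familySeries
  induction (Finset.univ : Finset ι) using Finset.induction_on with
  | empty => simp
  | insert i s hi ih =>
    rw [Finset.prod_insert hi, Finset.sum_insert hi, Derivation.leibniz, ih, derivative_rescale,
      ← besselSeries_mul_logDeriv, map_mul, smul_eq_mul, smul_eq_mul]
    ring

/-- The `n`-th normalized power mean of a finite family. -/
noncomputable def powerMean (x : ι → ℝ) (n : ℕ) : ℝ := (∑ i, x i ^ n) / Fintype.card ι

/-- The normalized coefficient `p! N⁻ᵖ [tᵖ] ∏ I(xᵢ t)`. -/
noncomputable def seriesMoment (x : ι → ℝ) (p : ℕ) : ℝ :=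
  p.factorial * ((Fintype.card ι : ℝ)⁻¹) ^ p * coeff p (familySeries x)

theorem seriesMoment_zero (x : ι → ℝ) : seriesMoment x 0 = 1 := by
  simp [seriesMoment, familySeries, map_prod, ← coeff_zero_eq_constantCoeff_apply, coeff_rescale,
    besselSeries]

/-- This is the coefficient of `tᵖ` in `F' = F * ∑ xᵢ L(xᵢ t)`, where the coefficients of the second
factor are power sums of `x`. The falling factorial is what remains of `p! / (p - k)!` after
normalization. -/
theorem seriesMoment_succ [Nonempty ι] (x : ι → ℝ) (p : ℕ) :
    seriesMoment x (p + 1) = ∑ k ∈ Finset.range (p + 1), (p.descFactorial k : ℝ)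
      * ((Fintype.card ι : ℝ)⁻¹) ^ k * coeff k besselLogDeriv * powerMean x (k + 1)
      * seriesMoment x (p - k) := by
  have hN : (Fintype.card ι : ℝ) ≠ 0 := by exact_mod_cast Fintype.card_ne_zero
  have h := congrArg (coeff p) (derivative_familySeries x)
  rw [coeff_derivative, mul_comm (familySeries x), coeff_mul,
    Finset.Nat.sum_antidiagonal_eq_sum_range_succ_mk] at h
  have hL : ∀ k, coeff k (∑ i, C (x i) * rescale (x i) besselLogDeriv)
      = Fintype.card ι * powerMean x (k + 1) * coeff k besselLogDeriv := by
    intro k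
    rw [powerMean, mul_div_cancel₀ _ hN, map_sum, Finset.sum_mul]
    refine Finset.sum_congr rfl fun i _ => ?_
    rw [coeff_C_mul, coeff_rescale, pow_succ']
    ring
  simp only [hL] at h
  have : seriesMoment x (p + 1) = p.factorial * ((Fintype.card ι : ℝ)⁻¹) ^ (p + 1)
      * (coeff (p + 1) (familySeries x) * ((p : ℝ) + 1)) := by
    rw [seriesMoment, Nat.factorial_succ]; push_cast; ring
  rw [this, h, Finset.mul_sum]
  refine Finset.sum_congr rfl fun k hk => ?_
  have hk' : k ≤ p := Nat.lt_succ_iff.mp (Finset.mem_range.mp hk)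
  rw [seriesMoment, ← Nat.factorial_mul_descFactorial hk']
  obtain ⟨q, rfl⟩ := Nat.exists_eq_add_of_le hk'
  rw [Nat.add_sub_cancel_left]
  push_cast
  rw [pow_succ, pow_add]
  field_simp

/-- Since `1 / n!² ≤ 1 / n!`, the product of the series is dominated coefficientwise by `∏ exp(xᵢ t)
= exp(N t)`. -/
theorem seriesMoment_nonneg_le_one [Nonempty ι] {x : ι → ℝ} (hx : ∀ i, 0 ≤ x i)
    (hs : ∑ i, x i = Fintype.card ι) (p : ℕ) : 0 ≤ seriesMoment x p ∧ seriesMoment x p ≤ 1 := by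
  have hN : (Fintype.card ι : ℝ) ≠ 0 := by exact_mod_cast Fintype.card_ne_zero
  have hp : (p.factorial : ℝ) ≠ 0 := by positivity
  have h := coeff_prod_nonneg_le (s := Finset.univ) (f := fun i => rescale (x i) besselSeries)
    (g := fun i => rescale (x i) (PowerSeries.exp ℝ)) (fun i _ n => by
      simp only [coeff_rescale, besselSeries, coeff_mk, coeff_exp, one_div, map_inv₀,
        map_natCast]
      have h1 : (1 : ℝ) ≤ n.factorial := by exact_mod_cast n.factorial_pos
      refine ⟨mul_nonneg (pow_nonneg (hx i) _) (by positivity),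
        mul_le_mul_of_nonneg_left ?_ (pow_nonneg (hx i) _)⟩
      exact inv_anti₀ (by positivity) (by nlinarith)) p
  rw [prod_rescale_exp, hs, coeff_rescale, coeff_exp] at h
  simp only [map_div₀, map_one, map_natCast] at h
  refine ⟨mul_nonneg (by positivity) h.1, ?_⟩
  refine (mul_le_mul_of_nonneg_left h.2 (by positivity)).trans_eq ?_
  rw [inv_pow]
  field_simp

theorem powerMean_zero [Nonempty ι] (x : ι → ℝ) : powerMean x 0 = 1 := by
  simp [powerMean]

theorem powerMean_nonneg {x : ι → ℝ} (hx : ∀ i, 0 ≤ x i) (n : ℕ) : 0 ≤ powerMean x n :=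
  div_nonneg (Finset.sum_nonneg fun i _ => pow_nonneg (hx i) n) (Nat.cast_nonneg _)

/-- Chebyshev's sum inequality: powers of a nonnegative family are similarly ordered. -/
theorem powerMean_mul_le {x : ι → ℝ} (hx : ∀ i, 0 ≤ x i) (m n : ℕ) :
    powerMean x m * powerMean x n ≤ powerMean x (m + n) := by
  have hmono : Monovary (fun i => x i ^ m) (fun i => x i ^ n) := fun i j hij =>
    pow_le_pow_left₀ (hx i) (le_of_not_ge fun h =>
      absurd (pow_le_pow_left₀ (hx j) h n) (not_le.mpr hij)) m
  have h := hmono.sum_mul_sum_le_card_mul_sum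
  rcases (Nat.cast_nonneg (α := ℝ) (Fintype.card ι)).eq_or_lt with h0 | h0
  · simp [powerMean, ← h0]
  · rw [powerMean, powerMean, powerMean, div_mul_div_comm, div_le_div_iff₀ (by positivity) h0]
    simp only [pow_add]
    nlinarith

end Family

end Series

/-! ### Expansion of the conditional moments in the power means -/

/-- The recursion and the bounds satisfied by the normalized coefficients `h` of the product series
of a nonnegative family of mean one, with power means `y` and inverse cardinality `ε`. -/
structure IsMomentRecursion (ε : ℝ) (y h : ℕ → ℝ) : Prop where
  eps_nonneg : 0 ≤ ε
  eps_le_one : ε ≤ 1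
  mean_zero : y 0 = 1
  mean_one : y 1 = 1
  mean_nonneg : ∀ n, 0 ≤ y n
  mean_mul_le : ∀ m n, y m * y n ≤ y (m + n)
  abs_moment_le : ∀ p, |h p| ≤ 1
  moment_zero : h 0 = 1
  moment_succ : ∀ p, h (p + 1) = ∑ k ∈ Finset.range (p + 1), (p.descFactorial k : ℝ)
      * ε ^ k * PowerSeries.coeff k besselLogDeriv * y (k + 1) * h (p - k)

/-- The coefficient of `εᵏ` in the expansion of the `p`-th normalized coefficient. -/
noncomputable def expansionCoeff (y : ℕ → ℝ) (p : ℝ) : ℕ → ℝ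
  | 0 => 1
  | 1 => -(p * (p - 1) / 4 * y 2)
  | 2 => p * (p - 1) * (p - 2) / 9 * y 3 + p * (p - 1) * (p - 2) * (p - 3) / 32 * y 2 ^ 2
  | 3 => -(11 / 192 * (p * (p - 1) * (p - 2) * (p - 3)) * y 4
      + p * (p - 1) * (p - 2) * (p - 3) * (p - 4) / 36 * (y 2 * y 3)
      + p * (p - 1) * (p - 2) * (p - 3) * (p - 4) * (p - 5) / 384 * y 2 ^ 3)
  | _ => 0

/-- The expansion of the `p`-th normalized coefficient, truncated at order `εʲ`. -/
noncomputable def truncatedExpansion (ε : ℝ) (y : ℕ → ℝ) (j : ℕ) (p : ℝ) : ℝ :=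
  ∑ k ∈ Finset.range j, ε ^ k * expansionCoeff y p k

/-- The truncation solves the recursion exactly, order by order in `ε`; this is what fixes the
polynomials in `expansionCoeff`. A factor truncated at order zero is an empty sum. -/
theorem truncatedExpansion_succ (ε : ℝ) (y : ℕ → ℝ) {j : ℕ} (hj : j ≤ 4) (p : ℕ) :
    truncatedExpansion ε y j ((p + 1 : ℕ) : ℝ) = truncatedExpansion ε y j p
      + (p.descFactorial 1 : ℝ) * ε ^ 1 * (-1 / 2) * y 2 * truncatedExpansion ε y (j - 1) (p - 1 : ℕ)
      + (p.descFactorial 2 : ℝ) * ε ^ 2 * (1 / 3) * y 3 * truncatedExpansion ε y (j - 2) (p - 2 : ℕ)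
      + (p.descFactorial 3 : ℝ) * ε ^ 3 * (-11 / 48) * y 4
        * truncatedExpansion ε y (j - 3) (p - 3 : ℕ) := by
  -- For `p ≤ 2` some subtraction `p - k` is cut off at zero, but then `p.descFactorial k` vanishes.
  rcases p with _ | _ | _ | p <;> interval_cases j <;>
  simp only [truncatedExpansion, Finset.sum_range_succ, Finset.sum_range_zero, expansionCoeff,
    Nat.descFactorial_succ, Nat.descFactorial_zero, Nat.sub_self, Nat.add_sub_cancel, Nat.sub_zero,
    Nat.zero_sub, Nat.reduceSub, Nat.reduceSubDiff, zero_add] <;>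
  push_cast <;> ring

/-! ### Error of the truncated expansion -/

namespace IsMomentRecursion

variable {ε : ℝ} {y h : ℕ → ℝ}

theorem mean_mono (H : IsMomentRecursion ε y h) : Monotone y :=
  monotone_nat_of_le_succ fun n => by simpa [H.mean_one] using H.mean_mul_le n 1

theorem one_le_mean (H : IsMomentRecursion ε y h) (n : ℕ) : 1 ≤ y n :=
  H.mean_zero ▸ H.mean_mono n.zero_le

theorem moment_succ_eq_add (H : IsMomentRecursion ε y h) (p : ℕ) :
    h (p + 1) = h p
      + (p.descFactorial 1 : ℝ) * ε ^ 1 * (-1 / 2) * y 2 * h (p - 1)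
      + (p.descFactorial 2 : ℝ) * ε ^ 2 * (1 / 3) * y 3 * h (p - 2)
      + (p.descFactorial 3 : ℝ) * ε ^ 3 * (-11 / 48) * y 4 * h (p - 3)
      + ∑ k ∈ Finset.range (p + 1), (p.descFactorial (4 + k) : ℝ)
      * ε ^ (4 + k) * PowerSeries.coeff (4 + k) besselLogDeriv * y (4 + k + 1)
      * h (p - (4 + k)) := by
  -- Lengthening the sum is harmless because the falling factorials vanish beyond `p`; the first
  -- four terms can then be split off for every `p`.
  have hsub : Finset.range (p + 1) ⊆ Finset.range (4 + (p + 1)) :=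
    Finset.range_subset_range.mpr (by omega)
  rw [H.moment_succ, Finset.sum_subset hsub, Finset.sum_range_add]
  · congr 1
    simp [Finset.sum_range_succ, coeff_besselLogDeriv_one, coeff_besselLogDeriv_two,
      coeff_besselLogDeriv_three,
      coeff_besselLogDeriv_zero, H.mean_one, -PowerSeries.coeff_zero_eq_constantCoeff]
  · intro k _ hk
    rw [Nat.descFactorial_of_lt (by simpa using hk)]
    simp

/-- Bounds of the shape `C * ε ^ j * y p` reproduce themselves under the recursion: the powers of
`ε` combine, and `y (k + 1) * y (p - k) ≤ y (p + 1)`. If `k > j`, the surplus powers of `ε` are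
dropped, as `ε ≤ 1`. -/
theorem abs_term_le (H : IsMomentRecursion ε y h) {p k j : ℕ} {C e : ℝ} (c : ℝ) (hC : 0 ≤ C)
    (he : |e| ≤ C * ε ^ (j - k) * y (p - k)) :
    |(p.descFactorial k : ℝ) * ε ^ k * c * y (k + 1) * e|
      ≤ p.descFactorial k * |c| * C * ε ^ j * y (p + 1) := by
  rcases lt_or_ge p k with hpk | hpk
  · simp [Nat.descFactorial_of_lt hpk]
  · have h1 : y (k + 1) * y (p - k) ≤ y (p + 1) :=
      (H.mean_mul_le _ _).trans_eq (by congr 1; omega)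
    have h2 : ε ^ k * ε ^ (j - k) ≤ ε ^ j := by
      rw [← pow_add]; exact pow_le_pow_of_le_one H.eps_nonneg H.eps_le_one (by omega)
    have hy := H.mean_nonneg
    have hε := H.eps_nonneg
    rw [abs_mul, abs_mul, abs_mul, abs_mul, abs_of_nonneg (hy _), Nat.abs_cast,
      abs_of_nonneg (pow_nonneg hε k)]
    calc _ ≤ (p.descFactorial k : ℝ) * ε ^ k * |c| * y (k + 1)
          * (C * ε ^ (j - k) * y (p - k)) := by
          have := hy (k + 1); gcongr
      _ = p.descFactorial k * |c| * C * ((ε ^ k * ε ^ (j - k)) * (y (k + 1) * y (p - k))) := by ring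
      _ ≤ p.descFactorial k * |c| * C * (ε ^ j * y (p + 1)) := by
          have := mul_nonneg (hy (k + 1)) (hy (p - k)); gcongr
      _ = _ := by ring

/-- Strong induction on `p`, for all `j` at once, since the `k`-th term of the recursion already
carries `εᵏ` and needs only precision `j - k`. The factor `y p` absorbs the size of the power means
and is integrated only later. -/
theorem exists_abs_sub_truncatedExpansion_le (p : ℕ) : ∀ j ≤ 4, ∃ C : ℝ, 0 ≤ C ∧
    ∀ (ε : ℝ) (y h : ℕ → ℝ), IsMomentRecursion ε y h →
      |h p - truncatedExpansion ε y j p| ≤ C * ε ^ j * y p := by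
  induction p using Nat.strong_induction_on with
  | _ p ih =>
  rcases p with _ | p
  · refine fun j hj => ⟨1, zero_le_one, fun ε y h H => ?_⟩
    rw [H.moment_zero, H.mean_zero]
    interval_cases j <;> simp [truncatedExpansion, Finset.sum_range_succ, expansionCoeff,
      H.eps_nonneg]
  · intro j hj
    have ih' : ∀ k, ∃ C : ℝ, 0 ≤ C ∧ ∀ (ε : ℝ) (y h : ℕ → ℝ), IsMomentRecursion ε y h →
        |h (p - k) - truncatedExpansion ε y (j - k) (p - k : ℕ)| ≤ C * ε ^ (j - k) * y (p - k) :=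
      fun k => ih (p - k) (by omega) (j - k) (by omega)
    choose C hC hb using ih'
    set D : ℝ := ∑ k ∈ Finset.range (p + 1), (p.descFactorial (4 + k) : ℝ)
      * |PowerSeries.coeff (4 + k) besselLogDeriv| * 1
    have hD : 0 ≤ D := Finset.sum_nonneg fun k _ => by positivity
    refine ⟨C 0 + p.descFactorial 1 * |(-1 / 2 : ℝ)| * C 1 + p.descFactorial 2 * |(1 / 3 : ℝ)| * C 2
      + p.descFactorial 3 * |(-11 / 48 : ℝ)| * C 3 + D, ?_, fun ε y h H => ?_⟩
    · have := hC 0; have := hC 1; have := hC 2; have := hC 3; positivity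
    · rw [H.moment_succ_eq_add, truncatedExpansion_succ ε y hj]
      have b0 := hb 0 ε y h H
      have b1 := H.abs_term_le (-1 / 2) (hC 1) (hb 1 ε y h H)
      have b2 := H.abs_term_le (1 / 3) (hC 2) (hb 2 ε y h H)
      have b3 := H.abs_term_le (-11 / 48) (hC 3) (hb 3 ε y h H)
      have hε := H.eps_nonneg
      have b0' : |h p - truncatedExpansion ε y j p| ≤ C 0 * ε ^ j * y (p + 1) :=
        b0.trans (mul_le_mul_of_nonneg_left (H.mean_mono p.le_succ)
          (mul_nonneg (hC 0) (pow_nonneg hε j)))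
      have b4 : |∑ k ∈ Finset.range (p + 1), (p.descFactorial (4 + k) : ℝ)
          * ε ^ (4 + k) * PowerSeries.coeff (4 + k) besselLogDeriv * y (4 + k + 1)
          * h (p - (4 + k))| ≤ D * ε ^ j * y (p + 1) := by
        rw [mul_assoc, Finset.sum_mul]
        refine (Finset.abs_sum_le_sum_abs _ _).trans (Finset.sum_le_sum fun k _ => ?_)
        rw [← mul_assoc]
        -- In the tail `k ≥ 4 ≥ j`, so no expansion is needed: the bound `|h| ≤ 1 ≤ y` suffices,
        -- with constant one.
        refine H.abs_term_le _ zero_le_one ?_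
        rw [Nat.sub_eq_zero_of_le (by omega : j ≤ 4 + k), pow_zero, one_mul, one_mul]
        exact (H.abs_moment_le _).trans (H.one_le_mean _)
      rw [abs_le] at *
      constructor <;> linarith [b0'.1, b0'.2, b1.1, b1.2, b2.1, b2.2, b3.1, b3.2, b4.1, b4.2]

end IsMomentRecursion

theorem isMomentRecursion_powerMean {ι : Type*} [Fintype ι] [Nonempty ι] {x : ι → ℝ}
    (hx : ∀ i, 0 ≤ x i) (hs : ∑ i, x i = Fintype.card ι) :
    IsMomentRecursion (Fintype.card ι : ℝ)⁻¹ (powerMean x) (seriesMoment x) where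
  eps_nonneg := by positivity
  eps_le_one := inv_le_one_of_one_le₀ (by exact_mod_cast Fintype.card_pos)
  mean_zero := powerMean_zero x
  mean_one := by
    simp only [powerMean, pow_one, hs]
    exact div_self (by exact_mod_cast Fintype.card_ne_zero)
  mean_nonneg := powerMean_nonneg hx
  mean_mul_le := powerMean_mul_le hx
  abs_moment_le p := by
    obtain ⟨h0, h1⟩ := seriesMoment_nonneg_le_one hx hs p
    rwa [abs_of_nonneg h0]
  moment_zero := seriesMoment_zero x
  moment_succ := seriesMoment_succ x

/-! ### Moments of a linear combination of independent uniform phases -/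

section Combination

variable {ι : Type*} [Fintype ι]

theorem sum_piAntidiag_multinomial_sq [DecidableEq ι] (x : ι → ℝ) (k : ℕ) :
    ∑ m ∈ Finset.univ.piAntidiag k, (Nat.multinomial Finset.univ m : ℝ) ^ 2 * ∏ i, x i ^ m i
      = (k.factorial : ℝ) ^ 2 * PowerSeries.coeff k (familySeries x) := by
  rw [familySeries, PowerSeries.coeff_prod, Finset.mul_sum]
  refine Finset.sum_bij' (fun m _ => Finsupp.equivFunOnFinite.symm m) (fun m _ => ⇑m) ?_ ?_ ?_ ?_ ?_
  · intro m hm; simpa [Finset.mem_finsuppAntidiag] using hm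
  · intro m hm; simpa [Finset.mem_finsuppAntidiag] using hm
  · intro m _; rfl
  · intro m _; ext; rfl
  · intro m hm
    have hk : ∑ i, m i = k := by simpa using hm
    have h := Nat.multinomial_spec (Finset.univ : Finset ι) m
    rw [hk] at h
    rw [← h]
    have h0 : (∏ i, (m i).factorial : ℝ) ≠ 0 := Finset.prod_ne_zero_iff.mpr fun i _ => by positivity
    simp only [besselSeries, PowerSeries.coeff_rescale, PowerSeries.coeff_mk,
      Finsupp.equivFunOnFinite_symm_apply_apply, Finset.prod_mul_distrib, Finset.prod_inv_distrib,
      Finset.prod_pow]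
    push_cast
    field_simp

/-- After multinomial expansion, orthogonality keeps only equal exponent vectors on both sides. The
squared multinomial coefficients `(k! / ∏ mᵢ!)²` are `k!²` times the coefficients produced by
`besselSeries`. -/
theorem integral_sum_pow_mul_conj_pow (z : ι → ℂ) (k l : ℕ) :
    ∫ b, (∑ i, (b i : ℂ) * z i) ^ k * (starRingEnd ℂ) (∑ i, (b i : ℂ) * z i) ^ l ∂torusMeasure ι
      = if k = l then (((k.factorial : ℝ) ^ 2
        * PowerSeries.coeff k (familySeries fun i => ‖z i‖ ^ 2) : ℝ) : ℂ) else 0 := by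
  classical
  have expand : ∀ b : ι → Circle,
      (∑ i, (b i : ℂ) * z i) ^ k * (starRingEnd ℂ) (∑ i, (b i : ℂ) * z i) ^ l
      = ∑ m ∈ Finset.univ.piAntidiag k, ∑ n ∈ Finset.univ.piAntidiag l,
        ((Nat.multinomial Finset.univ m : ℂ) * Nat.multinomial Finset.univ n
          * ∏ i, z i ^ m i * (starRingEnd ℂ) (z i) ^ n i)
        * ∏ i, (b i : ℂ) ^ ((m i : ℤ) - n i) := by
    intro b
    simp_rw [← circle_pow_mul_conj_pow]
    rw [map_sum, Finset.sum_pow_eq_sum_piAntidiag, Finset.sum_pow_eq_sum_piAntidiag,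
      Finset.sum_mul_sum]
    refine Finset.sum_congr rfl fun m _ => Finset.sum_congr rfl fun n _ => ?_
    simp only [map_mul, mul_pow, Finset.prod_mul_distrib]
    ring
  have hcont : ∀ m n : ι → ℕ, Continuous fun b : ι → Circle =>
      ((Nat.multinomial Finset.univ m : ℂ) * Nat.multinomial Finset.univ n
          * ∏ i, z i ^ m i * (starRingEnd ℂ) (z i) ^ n i)
        * ∏ i, (b i : ℂ) ^ ((m i : ℤ) - n i) := by
    intro m n
    simp_rw [← circle_pow_mul_conj_pow]
    have : ∀ i, Continuous fun b : ι → Circle => (b i : ℂ) :=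
      fun i => continuous_subtype_val.comp (continuous_apply i)
    exact continuous_const.mul (continuous_finsetProd _ fun i _ =>
      ((this i).pow _).mul ((Complex.continuous_conj.comp (this i)).pow _))
  simp_rw [expand]
  rw [integral_finsetSum _ fun m _ => integrable_finsetSum _ fun n _ =>
    integrable_of_continuous (hcont m n)]
  simp_rw [integral_finsetSum _ fun n _ => integrable_of_continuous (hcont _ n),
    integral_const_mul, integral_prod_zpow]
  have hdiff : ∀ m n : ι → ℕ, ((fun i => (m i : ℤ) - n i) = 0) ↔ m = n := fun m n => by
    simp [funext_iff, sub_eq_zero]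
  simp only [hdiff, mul_ite, mul_one, mul_zero, Finset.sum_ite_eq]
  split_ifs with hkl
  · subst hkl
    rw [← sum_piAntidiag_multinomial_sq]
    push_cast
    refine Finset.sum_congr rfl fun m hm => ?_
    rw [if_pos hm, ← sq]
    refine congrArg _ (Finset.prod_congr rfl fun i _ => ?_)
    rw [← mul_pow, Complex.mul_conj, Complex.normSq_eq_norm_sq]
    push_cast
    rfl
  · refine Finset.sum_eq_zero fun m hm => if_neg fun hm' => hkl ?_
    simp only [Finset.mem_piAntidiag] at hm hm'
    exact hm.1.symm.trans hm'.1

theorem norm_pow_two_mul_eq (w : ℂ) (p : ℕ) :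
    ((‖w‖ ^ (2 * p) : ℝ) : ℂ) = w ^ p * (starRingEnd ℂ) w ^ p := by
  rw [← mul_pow, Complex.mul_conj, Complex.normSq_eq_norm_sq, pow_mul]
  push_cast
  rfl

theorem integral_norm_sum_pow (z : ι → ℂ) (p : ℕ) :
    ∫ b, ‖∑ i, (b i : ℂ) * z i‖ ^ (2 * p) ∂torusMeasure ι
      = (p.factorial : ℝ) ^ 2 * PowerSeries.coeff p (familySeries fun i => ‖z i‖ ^ 2) := by
  have h := integral_sum_pow_mul_conj_pow z p p
  simp_rw [← norm_pow_two_mul_eq, if_true] at h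
  rw [integral_complex_ofReal] at h
  exact_mod_cast h

theorem coeff_familySeries_mul (c : ℝ) (x : ι → ℝ) (p : ℕ) :
    PowerSeries.coeff p (familySeries fun i => c * x i)
      = c ^ p * PowerSeries.coeff p (familySeries x) := by
  have : (familySeries fun i => c * x i) = PowerSeries.rescale c (familySeries x) := by
    simp only [familySeries, map_prod, PowerSeries.rescale_rescale, mul_comm]
  rw [this, PowerSeries.coeff_rescale]

theorem integral_norm_sum_div_sqrt_pow [Nonempty ι] (z : ι → ℂ) (p : ℕ) :
    ∫ b, (‖∑ i, (b i : ℂ) * z i‖ ^ 2 / Fintype.card ι) ^ p ∂torusMeasure ι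
      = p.factorial * seriesMoment (fun i => ‖z i‖ ^ 2) p := by
  simp_rw [div_pow, ← pow_mul]
  rw [integral_div, integral_norm_sum_pow, seriesMoment, inv_pow]
  field_simp

end Combination

/-! ### The spectral weights of a family of phases on a finite abelian group -/

section Group

variable {G : Type*} [AddCommGroup G] [Fintype G]

/-- The Fourier coefficient `∑ aᵢ χ(i)` of a family of phases. -/
noncomputable def fourierSum (a : G → Circle) (χ : AddChar G ℂ) : ℂ := ∑ i, (a i : ℂ) * χ i

/-- The normalized energy `|∑ aᵢ χ(i)|² / N` of a family of phases at a character. -/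
noncomputable def spectralWeight (a : G → Circle) (χ : AddChar G ℂ) : ℝ :=
  ‖fourierSum a χ‖ ^ 2 / Fintype.card G

theorem spectralWeight_nonneg (a : G → Circle) (χ : AddChar G ℂ) : 0 ≤ spectralWeight a χ := by
  unfold spectralWeight; positivity

@[fun_prop]
theorem continuous_fourierSum (χ : AddChar G ℂ) :
    Continuous fun a : G → Circle => fourierSum a χ :=
  continuous_finsetSum _ fun i _ =>
    (continuous_subtype_val.comp (continuous_apply i)).mul continuous_const

@[fun_prop]
theorem continuous_spectralWeight (χ : AddChar G ℂ) :
    Continuous fun a : G → Circle => spectralWeight a χ := by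
  unfold spectralWeight; fun_prop

theorem continuous_powerMean_spectralWeight (n : ℕ) :
    Continuous fun a : G → Circle => powerMean (spectralWeight a) n := by
  unfold powerMean; fun_prop

theorem card_cast_ne_zero : (Fintype.card G : ℝ) ≠ 0 := by exact_mod_cast Fintype.card_ne_zero

theorem sum_addChar_mul_conj [DecidableEq G] (i j : G) :
    ∑ χ : AddChar G ℂ, χ i * (starRingEnd ℂ) (χ j)
      = if i = j then (Fintype.card G : ℂ) else 0 := by
  simp_rw [← AddChar.map_neg_eq_conj, ← AddChar.map_add_eq_mul, ← sub_eq_add_neg,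
    AddChar.sum_apply_eq_ite, sub_eq_zero]

theorem sum_norm_sq_sum_addChar (c : G → ℂ) :
    ∑ χ : AddChar G ℂ, ‖∑ i, c i * χ i‖ ^ 2 = Fintype.card G * ∑ i, ‖c i‖ ^ 2 := by
  classical
  have : ∀ χ : AddChar G ℂ, ((‖∑ i, c i * χ i‖ ^ 2 : ℝ) : ℂ)
      = ∑ i, ∑ j, c i * (starRingEnd ℂ) (c j) * (χ i * (starRingEnd ℂ) (χ j)) := fun χ => by
    rw [← Complex.normSq_eq_norm_sq, ← Complex.mul_conj, map_sum, Finset.sum_mul_sum]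
    refine Finset.sum_congr rfl fun i _ => Finset.sum_congr rfl fun j _ => ?_
    rw [map_mul]; ring
  apply Complex.ofReal_injective
  push_cast
  push_cast at this
  simp_rw [this]
  rw [Finset.sum_comm]
  simp_rw [Finset.sum_comm (s := (Finset.univ : Finset (AddChar G ℂ))), ← Finset.mul_sum,
    sum_addChar_mul_conj]
  simp only [mul_ite, mul_zero, Finset.sum_ite_eq, Finset.mem_univ, if_true, Complex.mul_conj,
    Complex.normSq_eq_norm_sq, ← Finset.sum_mul]
  push_cast
  ring

/-- Parseval together with `|aᵢ| = 1`. This is the mean-one normalization on which the recursion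
rests. -/
theorem sum_spectralWeight (a : G → Circle) :
    ∑ χ, spectralWeight a χ = Fintype.card (AddChar G ℂ) := by
  simp only [spectralWeight, ← Finset.sum_div, fourierSum, sum_norm_sq_sum_addChar,
    AddChar.card_eq, Circle.norm_coe]
  simp

theorem isMomentRecursion_spectralWeight (a : G → Circle) :
    IsMomentRecursion (Fintype.card G : ℝ)⁻¹ (powerMean (spectralWeight a))
      (seriesMoment (spectralWeight a)) := by
  have := isMomentRecursion_powerMean (spectralWeight_nonneg a) (sum_spectralWeight a)
  rwa [AddChar.card_eq] at this

theorem continuous_seriesMoment_spectralWeight (p : ℕ) :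
    Continuous fun a : G → Circle => seriesMoment (spectralWeight a) p := by
  classical
  simp only [seriesMoment, familySeries, PowerSeries.coeff_prod, PowerSeries.coeff_rescale]
  fun_prop

theorem rescaledExcess_eq (ab : (G → Circle) × (AddChar G ℂ → Circle)) :
    rescaledExcess G ab
      = ∑ χ, (ab.2 χ : ℂ) * (fourierSum ab.1 χ * (Fintype.card G : ℂ)⁻¹) := by
  simp only [rescaledExcess, excess, fourierMatrix, Matrix.of_apply, fourierSum]
  rw [Finset.sum_comm, div_eq_mul_inv, Finset.sum_mul]
  refine Finset.sum_congr rfl fun χ _ => ?_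
  rw [← mul_assoc, Finset.mul_sum]
  congr 1
  refine Finset.sum_congr rfl fun i _ => ?_
  ring

theorem continuous_rescaledExcess : Continuous (rescaledExcess G) := by
  have h1 : ∀ i, Continuous fun ab : (G → Circle) × (AddChar G ℂ → Circle) => (ab.1 i : ℂ) :=
    fun i => continuous_subtype_val.comp ((continuous_apply i).comp continuous_fst)
  have h2 : ∀ i, Continuous fun ab : (G → Circle) × (AddChar G ℂ → Circle) => (ab.2 i : ℂ) :=
    fun i => continuous_subtype_val.comp ((continuous_apply i).comp continuous_snd)
  unfold rescaledExcess excess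
  fun_prop

theorem integral_rescaledExcess_pow (k l : ℕ) :
    ∫ ab, rescaledExcess G ab ^ k * (starRingEnd ℂ) (rescaledExcess G ab) ^ l
        ∂uniformPhases G (AddChar G ℂ)
      = if k = l then ((k.factorial * ∫ a, seriesMoment (spectralWeight a) k ∂torusMeasure G : ℝ) : ℂ)
        else 0 := by
  have hc : Continuous fun ab => rescaledExcess G ab ^ k
      * (starRingEnd ℂ) (rescaledExcess G ab) ^ l :=
    (continuous_rescaledExcess.pow k).mul
      ((Complex.continuous_conj.comp continuous_rescaledExcess).pow l)
  rw [uniformPhases, integral_prod _ (integrable_of_continuous hc)]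
  simp_rw [rescaledExcess_eq, integral_sum_pow_mul_conj_pow]
  split_ifs with hkl
  · rw [integral_complex_ofReal, ← integral_const_mul]
    congr 2 with a
    have : (fun χ => ‖fourierSum a χ * (Fintype.card G : ℂ)⁻¹‖ ^ 2)
        = fun χ => (Fintype.card G : ℝ)⁻¹ * spectralWeight a χ := by
      ext χ
      rw [spectralWeight, norm_mul, norm_inv, Complex.norm_natCast]
      field_simp
    rw [this, coeff_familySeries_mul, seriesMoment, AddChar.card_eq]
    ring
  · simp

theorem glowMoment_eq (p : ℕ) :
    glowMoment G p = p.factorial * ∫ a, seriesMoment (spectralWeight a) p ∂torusMeasure G := by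
  have h := integral_rescaledExcess_pow (G := G) p p
  simp_rw [← norm_pow_two_mul_eq, if_true] at h
  rw [integral_complex_ofReal] at h
  exact_mod_cast h

/-- Moments of a combination of uniform phases depend only on the moduli of its coefficients, here
all equal to one. Hence neither `χ` nor the structure of `G` matters. -/
theorem integral_spectralWeight_pow (χ : AddChar G ℂ) (n : ℕ) :
    ∫ a, spectralWeight a χ ^ n ∂torusMeasure G
      = n.factorial * seriesMoment (fun _ : G => (1 : ℝ)) n := by
  have h := integral_norm_sum_div_sqrt_pow (fun i => χ i) n
  simpa [spectralWeight, fourierSum] using h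

theorem integral_powerMean_spectralWeight (n : ℕ) :
    ∫ a, powerMean (spectralWeight a) n ∂torusMeasure G
      = n.factorial * seriesMoment (fun _ : G => (1 : ℝ)) n := by
  unfold powerMean
  rw [integral_div, integral_finsetSum _ fun χ _ =>
    integrable_of_continuous (by fun_prop)]
  simp_rw [integral_spectralWeight_pow]
  simp [mul_div_cancel_left₀]

theorem powerMean_one (n : ℕ) : powerMean (fun _ : G => (1 : ℝ)) n = 1 := by
  simp [powerMean]

variable (G) in
theorem isMomentRecursion_one :
    IsMomentRecursion (Fintype.card G : ℝ)⁻¹ (powerMean fun _ : G => (1 : ℝ))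
      (seriesMoment fun _ : G => (1 : ℝ)) :=
  isMomentRecursion_powerMean (fun _ => zero_le_one) (by simp)

theorem integral_powerMean_le (n : ℕ) :
    ∫ a, powerMean (spectralWeight a) n ∂torusMeasure G ≤ n.factorial := by
  rw [integral_powerMean_spectralWeight]
  exact mul_le_of_le_one_right (by positivity)
    ((le_abs_self _).trans ((isMomentRecursion_one G).abs_moment_le n))

variable (G) in
theorem seriesMoment_one_two :
    seriesMoment (fun _ : G => (1 : ℝ)) 2 = 1 - (Fintype.card G : ℝ)⁻¹ / 2 := by
  have H := (isMomentRecursion_one G).moment_succ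
  have h1 := H 0
  have h2 := H 1
  simp [Finset.sum_range_succ, powerMean_one, coeff_besselLogDeriv_zero, coeff_besselLogDeriv_one,
    -PowerSeries.coeff_zero_eq_constantCoeff, seriesMoment_zero] at h1 h2
  rw [h2, h1]; ring

variable (G) in
theorem seriesMoment_one_three :
    seriesMoment (fun _ : G => (1 : ℝ)) 3
      = 1 - 3 / 2 * (Fintype.card G : ℝ)⁻¹ + 2 / 3 * ((Fintype.card G : ℝ)⁻¹) ^ 2 := by
  have H := (isMomentRecursion_one G).moment_succ
  have h1 := H 0
  have h3 := H 2
  simp [Finset.sum_range_succ, powerMean_one, coeff_besselLogDeriv_zero, coeff_besselLogDeriv_one,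
    -PowerSeries.coeff_zero_eq_constantCoeff, seriesMoment_zero, coeff_besselLogDeriv_two] at h1 h3
  rw [h3, h1, seriesMoment_one_two]; ring

theorem integral_powerMean_two :
    ∫ a, powerMean (spectralWeight a) 2 ∂torusMeasure G = 2 - (Fintype.card G : ℝ)⁻¹ := by
  rw [integral_powerMean_spectralWeight, seriesMoment_one_two]
  norm_num [Nat.factorial]; ring

theorem integral_powerMean_three :
    ∫ a, powerMean (spectralWeight a) 3 ∂torusMeasure G
      = 6 - 9 * (Fintype.card G : ℝ)⁻¹ + 4 * ((Fintype.card G : ℝ)⁻¹) ^ 2 := by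
  rw [integral_powerMean_spectralWeight, seriesMoment_one_three]
  norm_num [Nat.factorial]; ring

theorem exists_abs_integral_powerMean_sub_le (n : ℕ) : ∃ C : ℝ, ∀ (G : Type*) [AddCommGroup G]
    [Fintype G], |∫ a, powerMean (spectralWeight a) n ∂torusMeasure G - n.factorial|
      ≤ C * (Fintype.card G : ℝ)⁻¹ := by
  obtain ⟨C, -, hC⟩ := IsMomentRecursion.exists_abs_sub_truncatedExpansion_le n 1 (by norm_num)
  refine ⟨n.factorial * C, fun G _ _ => ?_⟩
  have := hC _ _ _ (isMomentRecursion_one G)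
  simp only [truncatedExpansion, Finset.sum_range_one, pow_zero, expansionCoeff, pow_one,
    powerMean_one, mul_one] at this
  rw [integral_powerMean_spectralWeight, ← mul_sub_one, abs_mul, Nat.abs_cast, mul_assoc]
  gcongr

end Group

/-! ### Joint moments of the spectral weights to leading order -/

/-- Non-injective tuples form a proportion `O(1/N)` of all tuples. -/
theorem pow_le_descFactorial_add (N n : ℕ) :
    N ^ n ≤ N.descFactorial n + n ^ 2 * N ^ (n - 1) := by
  induction n with
  | zero => simp
  | succ n ih =>
    rw [Nat.descFactorial_succ, Nat.add_sub_cancel]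
    have h1 : N ≤ (N - n) + n := by omega
    have h2 : N.descFactorial n ≤ N ^ n := Nat.descFactorial_le_pow N n
    have h3 : N * (n ^ 2 * N ^ (n - 1)) = n ^ 2 * N ^ n := by
      rcases n with _ | n
      · simp
      · rw [Nat.add_sub_cancel, pow_succ N]; ring
    calc N ^ (n + 1) = N * N ^ n := by ring
      _ ≤ N * (N.descFactorial n + n ^ 2 * N ^ (n - 1)) := by gcongr
      _ = N * N.descFactorial n + n ^ 2 * N ^ n := by rw [mul_add, h3]
      _ ≤ ((N - n) + n) * N.descFactorial n + n ^ 2 * N ^ n := by gcongr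
      _ = (N - n) * N.descFactorial n + (n * N.descFactorial n + n ^ 2 * N ^ n) := by ring
      _ ≤ (N - n) * N.descFactorial n + (n * N ^ n + n ^ 2 * N ^ n) := by gcongr
      _ ≤ (N - n) * N.descFactorial n + (n + 1) ^ 2 * N ^ n := by
          gcongr; rw [← add_mul]; gcongr; nlinarith

theorem card_not_injective_le (κ α : Type*) [Fintype κ] [Fintype α] [DecidableEq κ]
    [DecidablePred fun f : κ → α => ¬ Function.Injective f] :
    (Finset.univ.filter fun f : κ → α => ¬ Function.Injective f).card
      ≤ Fintype.card κ ^ 2 * Fintype.card α ^ (Fintype.card κ - 1) := by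
  classical
  have h1 : (Finset.univ.filter fun f : κ → α => Function.Injective f).card
      = (Fintype.card α).descFactorial (Fintype.card κ) := by
    rw [← Fintype.card_embedding_eq, ← Fintype.card_subtype]
    exact Fintype.card_congr (Equiv.subtypeInjectiveEquivEmbedding κ α)
  have h2 := Finset.card_filter_add_card_filter_not (s := (Finset.univ : Finset (κ → α)))
    (fun f : κ → α => Function.Injective f)
  rw [h1, Finset.card_univ, Fintype.card_fun] at h2
  have := pow_le_descFactorial_add (Fintype.card α) (Fintype.card κ)
  have h3 : (Finset.univ.filter fun f : κ → α => ¬ Function.Injective f).card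
    = (Finset.univ.filter fun f : κ → α => ¬ Function.Injective f).card := by congr
  omega

section Group

variable {G : Type*} [AddCommGroup G] [Fintype G] {κ : Type*} [Fintype κ]

theorem sum_mul_conj_addChar (χ ψ : AddChar G ℂ) [Decidable (χ = ψ)] :
    ∑ i, χ i * (starRingEnd ℂ) (ψ i) = if χ = ψ then (Fintype.card G : ℂ) else 0 := by
  classical
  have := AddChar.sum_eq_ite (χ - ψ)
  simp only [sub_eq_zero] at this
  rw [← this]
  refine Finset.sum_congr rfl fun i _ => ?_
  rw [AddChar.sub_apply, AddChar.map_neg_eq_conj]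

/-- The unimodular weight of a pair of index tuples. -/
noncomputable def tupleWeight (χ : κ → AddChar G ℂ) (f g : κ → G) : ℂ :=
  ∏ k, χ k (f k) * (starRingEnd ℂ) (χ k (g k))

theorem norm_tupleWeight (χ : κ → AddChar G ℂ) (f g : κ → G) : ‖tupleWeight χ f g‖ = 1 := by
  simp [tupleWeight]

variable [DecidableEq κ]

theorem integral_prod_norm_fourierSum_sq (χ : κ → AddChar G ℂ)
    [∀ f g : κ → G, Decidable (∃ σ : Equiv.Perm κ, g = f ∘ σ)] :
    ((∫ a, ∏ k, ‖fourierSum a (χ k)‖ ^ 2 ∂torusMeasure G : ℝ) : ℂ)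
      = ∑ f : κ → G, ∑ g : κ → G,
        if ∃ σ : Equiv.Perm κ, g = f ∘ σ then tupleWeight χ f g else 0 := by
  classical
  have expand : ∀ a : G → Circle, ((∏ k, ‖fourierSum a (χ k)‖ ^ 2 : ℝ) : ℂ)
      = ∑ f : κ → G, ∑ g : κ → G, tupleWeight χ f g
        * ∏ k, ((a (f k) : ℂ) * (starRingEnd ℂ) (a (g k) : ℂ)) := by
    intro a
    have h : ∀ k, ((‖fourierSum a (χ k)‖ ^ 2 : ℝ) : ℂ)
        = fourierSum a (χ k) * (starRingEnd ℂ) (fourierSum a (χ k)) := fun k => by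
      rw [Complex.mul_conj, Complex.normSq_eq_norm_sq]
    rw [Complex.ofReal_prod]
    simp_rw [h, Finset.prod_mul_distrib, fourierSum, map_sum]
    rw [Finset.prod_univ_sum, Finset.prod_univ_sum, Finset.sum_mul_sum, Fintype.piFinset_univ]
    refine Finset.sum_congr rfl fun f _ => Finset.sum_congr rfl fun g _ => ?_
    simp only [tupleWeight, map_mul, Finset.prod_mul_distrib]
    ring
  have hcont : ∀ f g : κ → G, Continuous fun a : G → Circle => tupleWeight χ f g
        * ∏ k, ((a (f k) : ℂ) * (starRingEnd ℂ) (a (g k) : ℂ)) := by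
    intro f g
    have : ∀ i, Continuous fun a : G → Circle => (a i : ℂ) :=
      fun i => continuous_subtype_val.comp (continuous_apply i)
    exact continuous_const.mul (continuous_finsetProd _ fun k _ =>
      (this _).mul (Complex.continuous_conj.comp (this _)))
  rw [← integral_complex_ofReal]
  simp_rw [expand]
  rw [integral_finsetSum _ fun f _ => integrable_finsetSum _ fun g _ =>
    integrable_of_continuous (hcont f g)]
  simp_rw [integral_finsetSum _ fun g _ => integrable_of_continuous (hcont _ g),
    integral_const_mul, integral_prod_mul_conj, mul_ite, mul_one, mul_zero]

/-- For a fixed permutation, taken inverted for convenience, the sum over `f` factors into the inner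
products of `χ k` with `χ (σ k)`. It survives only if `σ` preserves `χ`. -/
theorem sum_sum_perm_tupleWeight [DecidableEq (AddChar G ℂ)] (χ : κ → AddChar G ℂ) :
    ∑ f : κ → G, ∑ σ : Equiv.Perm κ, tupleWeight χ f (f ∘ σ)
      = (Fintype.card G : ℂ) ^ Fintype.card κ
        * Fintype.card {σ : Equiv.Perm κ // χ ∘ σ = χ} := by
  have key : ∀ σ : Equiv.Perm κ, ∑ f : κ → G, tupleWeight χ f (f ∘ ⇑σ⁻¹)
      = if χ ∘ σ = χ then (Fintype.card G : ℂ) ^ Fintype.card κ else 0 := by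
    intro σ
    have h : ∀ f : κ → G, tupleWeight χ f (f ∘ ⇑σ⁻¹)
        = ∏ k, χ k (f k) * (starRingEnd ℂ) (χ (σ k) (f k)) := by
      intro f
      rw [tupleWeight, Finset.prod_mul_distrib, Finset.prod_mul_distrib,
        ← Equiv.prod_comp σ fun k => (starRingEnd ℂ) (χ k ((f ∘ ⇑σ⁻¹) k))]
      simp
    simp_rw [h]
    have := Finset.prod_univ_sum (fun _ : κ => (Finset.univ : Finset G))
      (fun k i => χ k i * (starRingEnd ℂ) (χ (σ k) i))
    rw [Fintype.piFinset_univ] at this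
    rw [← this]
    simp_rw [sum_mul_conj_addChar, Finset.prod_ite_zero]
    simp only [Finset.prod_const, Finset.card_univ, funext_iff, Function.comp_apply,
      Finset.mem_univ, true_imp_iff, eq_comm]
  rw [Finset.sum_comm, ← Equiv.sum_comp (Equiv.inv (Equiv.Perm κ))]
  simp only [Equiv.inv_apply]
  simp_rw [key]
  rw [Finset.sum_ite, Finset.sum_const, Finset.sum_const_zero, add_zero, nsmul_eq_mul,
    Fintype.card_subtype, mul_comm]

/-- For injective `f`, its rearrangements correspond bijectively to permutations, so the exact sum
and the sum over permutations agree. For the few other `f`, each sum has at most `(card κ)!`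
unimodular terms. -/
theorem abs_integral_prod_norm_fourierSum_sq_sub_le [DecidableEq (AddChar G ℂ)]
    (χ : κ → AddChar G ℂ) :
    |∫ a, ∏ k, ‖fourierSum a (χ k)‖ ^ 2 ∂torusMeasure G
      - (Fintype.card G : ℝ) ^ Fintype.card κ * Fintype.card {σ : Equiv.Perm κ // χ ∘ σ = χ}|
      ≤ 2 * (Fintype.card κ).factorial * (Fintype.card κ ^ 2
        * (Fintype.card G : ℝ) ^ (Fintype.card κ - 1)) := by
  classical
  set d : (κ → G) → ℂ := fun f => (∑ g : κ → G,
    if ∃ σ : Equiv.Perm κ, g = f ∘ σ then tupleWeight χ f g else 0)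
      - ∑ σ : Equiv.Perm κ, tupleWeight χ f (f ∘ σ)
  have himage : ∀ f : κ → G, (Finset.univ.filter fun g => ∃ σ : Equiv.Perm κ, g = f ∘ σ)
      = Finset.univ.image fun σ : Equiv.Perm κ => f ∘ σ := fun f => by
    ext g; simp [eq_comm]
  have hinj : ∀ f : κ → G, Function.Injective f → d f = 0 := by
    intro f hf
    simp only [d]
    rw [← Finset.sum_filter, himage, Finset.sum_image, sub_self]
    exact fun σ _ τ _ h => Equiv.ext fun k => hf (congrFun h k)
  have hcard : Fintype.card (Equiv.Perm κ) = (Fintype.card κ).factorial := Fintype.card_perm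
  have hd : ∀ f : κ → G, ‖d f‖ ≤ 2 * (Fintype.card κ).factorial := by
    intro f
    simp only [d]
    rw [← Finset.sum_filter, himage, two_mul]
    refine (norm_sub_le _ _).trans (add_le_add ?_ ?_)
    · refine (norm_sum_le _ _).trans ?_
      simp only [norm_tupleWeight, Finset.sum_const, nsmul_eq_mul, mul_one, ← hcard]
      exact_mod_cast Finset.card_image_le
    · refine (norm_sum_le _ _).trans ?_
      simp only [norm_tupleWeight, Finset.sum_const, nsmul_eq_mul, mul_one, ← hcard,
        Finset.card_univ, le_refl]
  have hsum : ((∫ a, ∏ k, ‖fourierSum a (χ k)‖ ^ 2 ∂torusMeasure G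
      - (Fintype.card G : ℝ) ^ Fintype.card κ
        * Fintype.card {σ : Equiv.Perm κ // χ ∘ σ = χ} : ℝ) : ℂ) = ∑ f, d f := by
    simp only [d]
    rw [Finset.sum_sub_distrib, sum_sum_perm_tupleWeight, ← integral_prod_norm_fourierSum_sq]
    push_cast
    rfl
  rw [← Real.norm_eq_abs, ← Complex.norm_real, hsum,
    ← Finset.sum_filter_of_ne (p := fun f : κ → G => ¬ Function.Injective f)
      (fun f _ hf hi => hf (hinj f hi))]
  refine (norm_sum_le _ _).trans ((Finset.sum_le_card_nsmul _ _ _ fun f _ => hd f).trans ?_)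
  rw [nsmul_eq_mul, mul_comm]
  gcongr
  exact_mod_cast card_not_injective_le κ G

end Group

theorem card_stabilizer_sigma_fst {S : Type*} [Fintype S] [DecidableEq S] (n : S → ℕ) :
    Fintype.card {σ : Equiv.Perm (Σ s, Fin (n s)) //
      (Sigma.fst : (Σ s, Fin (n s)) → S) ∘ σ = Sigma.fst} = ∏ s, (n s).factorial := by
  rw [DomMulAct.stabilizer_card]
  refine Finset.prod_congr rfl fun s _ => ?_
  rw [Fintype.card_congr (Equiv.sigmaSubtype s), Fintype.card_fin]

/-- The product of power means is an average over tuples of characters indexed by `S`. For distinct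
characters, each repeated `n s` times, the stabilizer has order `∏ (n s)!`, the product of moments
of independent exponentials. Tuples with repetitions contribute `O(1/N)`. -/
theorem exists_abs_integral_prod_powerMean_sub_le {S : Type} [Fintype S] (n : S → ℕ) :
    ∃ C : ℝ, ∀ (G : Type*) [AddCommGroup G] [Fintype G],
      |∫ a, ∏ s, powerMean (spectralWeight a) (n s) ∂torusMeasure G
        - ∏ s, ((n s).factorial : ℝ)| ≤ C * (Fintype.card G : ℝ)⁻¹ := by
  classical
  set κ := Σ s, Fin (n s)
  set m := Fintype.card κ
  set A : ℝ := 2 * m.factorial * m ^ 2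
  set B : ℝ := m.factorial + ∏ s, ((n s).factorial : ℝ)
  refine ⟨A + Fintype.card S ^ 2 * B, fun G _ _ => ?_⟩
  set N : ℝ := (Fintype.card G : ℝ)
  have hN : 0 < N := Nat.cast_pos.mpr Fintype.card_pos
  have hpow : ∀ k : ℕ, (k : ℝ) ^ 2 * N ^ (k - 1) = (k : ℝ) ^ 2 * (N ^ k * N⁻¹) := by
    intro k
    rcases k with _ | k
    · simp
    · rw [Nat.add_sub_cancel, pow_succ N k, mul_inv_cancel_right₀ hN.ne']
  set V : (S → AddChar G ℂ) → ℝ := fun χ =>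
    ∫ a, ∏ s, spectralWeight a (χ s) ^ n s ∂torusMeasure G
  set c : (S → AddChar G ℂ) → ℝ := fun χ =>
    Fintype.card {σ : Equiv.Perm κ // (χ ∘ Sigma.fst) ∘ σ = χ ∘ Sigma.fst}
  have hV : ∀ χ, |V χ - c χ| ≤ A * N⁻¹ := by
    intro χ
    have h := abs_integral_prod_norm_fourierSum_sq_sub_le (κ := κ) (χ ∘ Sigma.fst)
    have hVχ : V χ = (N ^ m)⁻¹ * ∫ a, ∏ k : κ, ‖fourierSum a ((χ ∘ Sigma.fst) k)‖ ^ 2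
        ∂torusMeasure G := by
      rw [← integral_const_mul]
      refine integral_congr_ae (ae_of_all _ fun a => ?_)
      simp only [Function.comp_apply, κ, Fintype.prod_sigma, Finset.prod_const, Finset.card_univ,
        Fintype.card_fin, spectralWeight, div_pow, Finset.prod_div_distrib,
        Finset.prod_pow_eq_pow_sum, m, Fintype.card_sigma]
      rw [div_eq_mul_inv, mul_comm]
    have : V χ - c χ = (N ^ m)⁻¹ * (∫ a, ∏ k : κ, ‖fourierSum a ((χ ∘ Sigma.fst) k)‖ ^ 2
        ∂torusMeasure G - N ^ m * c χ) := by
      rw [mul_sub, ← hVχ, inv_mul_cancel_left₀ (pow_ne_zero _ hN.ne')]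
    rw [this, abs_mul, abs_of_nonneg (by positivity)]
    refine (mul_le_mul_of_nonneg_left h (by positivity)).trans_eq ?_
    rw [hpow]
    simp only [A, m]
    field_simp
  have hc : ∀ χ, c χ ≤ m.factorial := by
    intro χ
    simp only [c, m, ← Fintype.card_perm]
    exact_mod_cast Fintype.card_subtype_le _
  have hcinj : ∀ χ, Function.Injective χ → c χ = ∏ s, ((n s).factorial : ℝ) := by
    intro χ hχ
    rw [← Nat.cast_prod, ← card_stabilizer_sigma_fst]
    simp only [c, Function.comp_assoc, hχ.comp_left.eq_iff]
    rfl
  have hVinj : ∀ χ, |V χ - ∏ s, ((n s).factorial : ℝ)|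
      ≤ A * N⁻¹ + if ¬ Function.Injective χ then B else 0 := by
    intro χ
    by_cases hχ : Function.Injective χ
    · simpa [hχ, ← hcinj χ hχ] using hV χ
    · rw [if_pos hχ]
      refine (abs_sub_le _ (c χ) _).trans (add_le_add (hV χ) ?_)
      have h0 : (0 : ℝ) ≤ c χ := Nat.cast_nonneg _
      have h1 : (0 : ℝ) ≤ ∏ s, ((n s).factorial : ℝ) := by positivity
      have := hc χ
      rw [abs_le]
      constructor <;> simp only [B] <;> linarith
  set r := Fintype.card S
  have hcardχ : (Fintype.card (S → AddChar G ℂ) : ℝ) = N ^ r := by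
    rw [Fintype.card_fun, AddChar.card_eq]; push_cast; rfl
  have hint : ∫ a, ∏ s, powerMean (spectralWeight a) (n s) ∂torusMeasure G
      = (N ^ r)⁻¹ * ∑ χ, V χ := by
    simp only [V]
    rw [← integral_finsetSum _ fun χ _ => integrable_of_continuous (by fun_prop),
      ← integral_const_mul]
    refine integral_congr_ae (ae_of_all _ fun a => ?_)
    simp only [powerMean, Finset.prod_div_distrib, Finset.prod_const, Finset.card_univ,
      AddChar.card_eq]
    rw [Finset.prod_univ_sum, Fintype.piFinset_univ, div_eq_mul_inv, mul_comm]
  have hB : 0 ≤ B := by positivity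
  rw [hint, show (N ^ r)⁻¹ * ∑ χ, V χ - ∏ s, ((n s).factorial : ℝ)
      = (N ^ r)⁻¹ * ∑ χ, (V χ - ∏ s, ((n s).factorial : ℝ)) by
    rw [Finset.sum_sub_distrib, Finset.sum_const, Finset.card_univ, nsmul_eq_mul, hcardχ, mul_sub,
      inv_mul_cancel_left₀ (pow_ne_zero _ hN.ne')], abs_mul, abs_of_nonneg (by positivity)]
  have hcn : ((Finset.univ.filter fun χ : S → AddChar G ℂ => ¬ Function.Injective χ).card : ℝ)
      ≤ (r : ℝ) ^ 2 * (N ^ r * N⁻¹) := by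
    rw [← hpow]
    have := card_not_injective_le S (AddChar G ℂ)
    rw [AddChar.card_eq] at this
    exact (Nat.cast_le (α := ℝ).mpr this).trans_eq (by push_cast; rfl)
  calc (N ^ r)⁻¹ * |∑ χ, (V χ - ∏ s, ((n s).factorial : ℝ))|
      ≤ (N ^ r)⁻¹ * ∑ χ : S → AddChar G ℂ, (A * N⁻¹ + if ¬ Function.Injective χ then B else 0) := by
        gcongr
        exact (Finset.abs_sum_le_sum_abs _ _).trans (Finset.sum_le_sum fun χ _ => hVinj χ)
    _ = (N ^ r)⁻¹ * (N ^ r * (A * N⁻¹)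
        + (Finset.univ.filter fun χ : S → AddChar G ℂ => ¬ Function.Injective χ).card * B) := by
        rw [Finset.sum_add_distrib, Finset.sum_const, Finset.card_univ, nsmul_eq_mul, hcardχ,
          ← Finset.sum_filter, Finset.sum_const, nsmul_eq_mul]
    _ ≤ (N ^ r)⁻¹ * (N ^ r * (A * N⁻¹) + (r : ℝ) ^ 2 * (N ^ r * N⁻¹) * B) := by gcongr
    _ = (A + (r : ℝ) ^ 2 * B) * N⁻¹ := by field_simp

/-! ### The second moment of the quadratic power mean -/

section Group

variable {G : Type*} [AddCommGroup G]

/-- The exponents of the monomial `a_i a_j ā_k ā_l`, where `i + j = k + l`. -/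
def quadExponent [DecidableEq G] (q : (G × G) × G) (g : G) : ℤ :=
  (if g = q.1.1 then 1 else 0) + (if g = q.1.2 then 1 else 0) - (if g = q.2 then 1 else 0)
    - (if g = q.1.1 + q.1.2 - q.2 then 1 else 0)

/-- The monomial `a_i a_j ā_k ā_l`, where `i + j = k + l`. -/
noncomputable def quadMonomial (a : G → Circle) (q : (G × G) × G) : ℂ :=
  a q.1.1 * a q.1.2 * (starRingEnd ℂ) (a q.2 : ℂ) * (starRingEnd ℂ) (a (q.1.1 + q.1.2 - q.2) : ℂ)

/-- The additive quadruples `i + j = k + l` with `{i, j}` and `{k, l}` disjoint. -/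
def IsNontrivialQuad (q : (G × G) × G) : Prop := q.2 ≠ q.1.1 ∧ q.2 ≠ q.1.2

/-- The rearrangements of an additive quadruple. -/
def quadRearrangements [DecidableEq G] (q : (G × G) × G) : Finset ((G × G) × G) :=
  {(q.1.1, q.1.2), (q.1.2, q.1.1)} ×ˢ {q.2, q.1.1 + q.1.2 - q.2}

theorem IsNontrivialQuad.quadExponent_ne_zero [DecidableEq G] {q : (G × G) × G}
    (hq : IsNontrivialQuad q) : quadExponent q ≠ 0 := by
  obtain ⟨⟨i, j⟩, k⟩ := q
  intro h
  have h1 := congrFun h i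
  obtain ⟨hki, hkj⟩ := hq
  dsimp only at hki hkj
  have hl : i ≠ i + j - k := fun e => hkj (by rw [eq_sub_iff_add_eq] at e; exact add_left_cancel e)
  simp only [quadExponent, if_true, if_neg hki.symm, if_neg hl, Pi.zero_apply] at h1
  split_ifs at h1 <;> omega

/-- For a nontrivial quadruple nothing cancels, so the positive and negative parts of the exponent
recover the unordered pairs `{i, j}` and `{k, l}`. -/
theorem quadExponent_eq_iff [DecidableEq G] {q r : (G × G) × G} (hq : IsNontrivialQuad q)
    (hr : IsNontrivialQuad r) : quadExponent q = quadExponent r ↔ r ∈ quadRearrangements q := by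
  obtain ⟨⟨i, j⟩, k⟩ := q
  obtain ⟨⟨i', j'⟩, k'⟩ := r
  obtain ⟨hki, hkj⟩ := hq
  obtain ⟨hki', hkj'⟩ := hr
  dsimp only at hki hkj hki' hkj'
  simp only [quadRearrangements, Finset.mem_product, Finset.mem_insert, Finset.mem_singleton,
    Prod.mk.injEq]
  constructor
  · intro h
    have hli : i ≠ i + j - k := fun e => hkj (by
      rw [eq_sub_iff_add_eq] at e; exact add_left_cancel e)
    have hlj : j ≠ i + j - k := fun e => hki (by
      rw [eq_sub_iff_add_eq, add_comm i] at e; exact add_left_cancel e)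
    -- The positive values at `i` and `j` determine the pair `i', j'` up to order. The negative
    -- value at `k'` forces `k'` to be `k` or `l`.
    have hi := congrFun h i
    have hj := congrFun h j
    have hk' := congrFun h k'
    simp only [quadExponent, if_true, if_neg hki.symm, if_neg hkj.symm, if_neg hli, if_neg hlj,
      if_neg hki', if_neg hkj'] at hi hj hk'
    generalize i + j - k = l at *
    generalize i' + j' - k' = l' at *
    refine ⟨?_, ?_⟩
    · clear hk'
      grind
    · clear hi hj
      grind
  · rintro ⟨⟨h1, h2⟩ | ⟨h1, h2⟩, h3 | h3⟩ <;> funext g <;>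
    simp only [quadExponent, h1, h2, h3, sub_sub_cancel, add_comm j i] <;> ring

theorem card_quadRearrangements_le [DecidableEq G] (q : (G × G) × G) :
    (quadRearrangements q).card ≤ 4 := by
  rw [quadRearrangements, Finset.card_product]
  change _ ≤ 2 * 2
  exact Nat.mul_le_mul Finset.card_le_two Finset.card_le_two

theorem card_quadRearrangements [DecidableEq G] {q : (G × G) × G} (h : q.1.1 ≠ q.1.2)
    (h' : q.2 ≠ q.1.1 + q.1.2 - q.2) : (quadRearrangements q).card = 4 := by
  rw [quadRearrangements, Finset.card_product, Finset.card_pair fun e => h (congrArg Prod.fst e),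
    Finset.card_pair h']

theorem quadMonomial_of_not_isNontrivialQuad (a : G → Circle) {q : (G × G) × G}
    (hq : ¬ IsNontrivialQuad q) : quadMonomial a q = 1 := by
  obtain ⟨⟨i, j⟩, k⟩ := q
  have h : k = i ∨ k = j := by
    by_contra h
    exact hq (not_or.mp h)
  have hi := circle_mul_conj (a i)
  have hj := circle_mul_conj (a j)
  rcases h with h | h <;>
  simp only [quadMonomial, h, add_sub_cancel_left, add_sub_cancel_right] <;>
  linear_combination hi * ((a j : ℂ) * (starRingEnd ℂ) (a j : ℂ)) + hj

theorem continuous_quadMonomial (q : (G × G) × G) :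
    Continuous fun a : G → Circle => quadMonomial a q := by
  have h : ∀ i, Continuous fun a : G → Circle => (a i : ℂ) :=
    fun i => continuous_subtype_val.comp (continuous_apply i)
  exact (((h _).mul (h _)).mul (Complex.continuous_conj.comp (h _))).mul
    (Complex.continuous_conj.comp (h _))

variable [Fintype G]

theorem quadMonomial_eq_prod [DecidableEq G] (a : G → Circle) (q : (G × G) × G) :
    quadMonomial a q = ∏ g, (a g : ℂ) ^ quadExponent q g := by
  have h1 : ∀ i, ∏ g, (a g : ℂ) ^ (if g = i then (1 : ℤ) else 0) = a i := fun i => by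
    simp [Finset.prod_ite_eq', apply_ite]
  simp only [quadExponent, zpow_sub₀ (Circle.coe_ne_zero _), zpow_add₀ (Circle.coe_ne_zero _),
    Finset.prod_div_distrib, Finset.prod_mul_distrib, h1, quadMonomial, ← Circle.coe_inv_eq_conj,
    Circle.coe_inv]
  simp only [div_eq_mul_inv]

theorem integral_quadMonomial {q : (G × G) × G} (hq : IsNontrivialQuad q) :
    ∫ a, quadMonomial a q ∂torusMeasure G = 0 := by
  classical
  simp_rw [quadMonomial_eq_prod, integral_prod_zpow, if_neg hq.quadExponent_ne_zero]

theorem integral_quadMonomial_mul_conj [DecidableEq G] {q r : (G × G) × G}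
    (hq : IsNontrivialQuad q) (hr : IsNontrivialQuad r) :
    ∫ a, quadMonomial a q * (starRingEnd ℂ) (quadMonomial a r) ∂torusMeasure G
      = if r ∈ quadRearrangements q then 1 else 0 := by
  have h : ∀ a : G → Circle, quadMonomial a q * (starRingEnd ℂ) (quadMonomial a r)
      = ∏ g, (a g : ℂ) ^ (quadExponent q g - quadExponent r g) := fun a => by
    simp only [quadMonomial_eq_prod, map_prod, map_zpow₀, ← Circle.coe_inv_eq_conj, Circle.coe_inv,
      zpow_sub₀ (Circle.coe_ne_zero _), div_eq_mul_inv, inv_zpow,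
      Finset.prod_mul_distrib]
  simp_rw [h, integral_prod_zpow, ← quadExponent_eq_iff hq hr]
  congr 1
  rw [← sub_eq_zero (a := quadExponent q)]
  rfl

theorem fourierSum_sq (a : G → Circle) (χ : AddChar G ℂ) :
    fourierSum a χ ^ 2 = ∑ g, (∑ i, (a i : ℂ) * a (g - i)) * χ g := by
  simp_rw [Finset.sum_mul]
  rw [Finset.sum_comm, sq, fourierSum, Finset.sum_mul_sum]
  refine Finset.sum_congr rfl fun i _ => ?_
  rw [← Equiv.sum_comp (Equiv.subRight i)]
  refine Finset.sum_congr rfl fun g _ => ?_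
  rw [Equiv.subRight_apply, mul_mul_mul_comm, ← AddChar.map_add_eq_mul, add_sub_cancel]

/-- The square of a Fourier sum is the Fourier sum of the self-convolution of `a`. Parseval then
turns the fourth moment into a weighted additive energy. -/
theorem powerMean_two_eq_sum (a : G → Circle) :
    (((Fintype.card G : ℝ) ^ 2 * powerMean (spectralWeight a) 2 : ℝ) : ℂ)
      = ∑ q, quadMonomial a q := by
  have h1 : (Fintype.card G : ℝ) ^ 2 * powerMean (spectralWeight a) 2
      = ∑ g, ‖∑ i, (a i : ℂ) * a (g - i)‖ ^ 2 := by
    have h2 := sum_norm_sq_sum_addChar fun g => ∑ i, (a i : ℂ) * a (g - i)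
    simp_rw [← fourierSum_sq, norm_pow] at h2
    have h0 := card_cast_ne_zero (G := G)
    rw [powerMean, AddChar.card_eq]
    simp only [spectralWeight, div_pow, ← Finset.sum_div, h2]
    field_simp
  rw [h1]
  push_cast
  have h3 : ∀ g : G, ((‖∑ i, (a i : ℂ) * a (g - i)‖ : ℂ)) ^ 2
      = ∑ i, ∑ k, ((a i : ℂ) * a (g - i))
        * ((starRingEnd ℂ) (a k : ℂ) * (starRingEnd ℂ) (a (g - k) : ℂ)) := fun g => by
    rw [← Complex.ofReal_pow, ← Complex.normSq_eq_norm_sq, ← Complex.mul_conj, map_sum,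
      Finset.sum_mul_sum]
    simp only [map_mul]
  simp_rw [h3]
  rw [Finset.sum_comm, Fintype.sum_prod_type, Fintype.sum_prod_type]
  refine Finset.sum_congr rfl fun i _ => ?_
  rw [← Equiv.sum_comp (Equiv.addLeft i)]
  refine Finset.sum_congr rfl fun j _ => Finset.sum_congr rfl fun k _ => ?_
  simp only [Equiv.coe_addLeft, add_sub_cancel_left, quadMonomial]
  ring

/-- `D` is the variance of `N² y 2`. Trivial quadruples contribute the constant mean; the others are
centred, and each correlates only with its rearrangements, generically four in number. -/
theorem integral_sq_powerMean_two_sub :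
    ∃ D : ℝ, |D - 4 * (Fintype.card G : ℝ) ^ 3| ≤ 16 * (Fintype.card G : ℝ) ^ 2 ∧
      (Fintype.card G : ℝ) ^ 4 * ∫ a, powerMean (spectralWeight a) 2 ^ 2 ∂torusMeasure G
        = (Fintype.card G : ℝ) ^ 4 * (2 - (Fintype.card G : ℝ)⁻¹) ^ 2 + D := by
  classical
  set N : ℝ := (Fintype.card G : ℝ)
  set S : Finset ((G × G) × G) := Finset.univ.filter IsNontrivialQuad
  set t : ℕ := (Finset.univ.filter fun q : (G × G) × G => ¬ IsNontrivialQuad q).card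
  have hS : ∀ {q}, q ∈ S ↔ IsNontrivialQuad q := by simp [S]
  have hX : ∀ a : G → Circle, ((N ^ 2 * powerMean (spectralWeight a) 2 : ℝ) : ℂ)
      = t + ∑ q ∈ S, quadMonomial a q := fun a => by
    rw [powerMean_two_eq_sum, ← Finset.sum_filter_not_add_sum_filter _ IsNontrivialQuad]
    congr 1
    rw [Finset.sum_congr rfl fun q hq => quadMonomial_of_not_isNontrivialQuad a
      (Finset.mem_filter.mp hq).2]
    simp [t]
  have hint : ∀ {f : (G → Circle) → ℝ}, Continuous f → Integrable f (torusMeasure G) :=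
    fun hf => integrable_of_continuous hf
  have hc := continuous_powerMean_spectralWeight (G := G) 2
  -- The number of trivial quadruples comes from the known mean of `y 2`, without a direct count.
  have ht : N ^ 2 * (2 - N⁻¹) = t := by
    have h : ((∫ a, N ^ 2 * powerMean (spectralWeight a) 2 ∂torusMeasure G : ℝ) : ℂ) = t := by
      rw [← integral_complex_ofReal]
      simp_rw [hX]
      rw [integral_add (integrable_of_continuous continuous_const)
        (integrable_finsetSum _ fun q _ => integrable_of_continuous (continuous_quadMonomial q)),
        integral_finsetSum _ fun q _ => integrable_of_continuous (continuous_quadMonomial q),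
        Finset.sum_eq_zero fun q hq => integral_quadMonomial (hS.mp hq)]
      simp
    rw [integral_const_mul, integral_powerMean_two] at h
    exact_mod_cast h
  set D : ℝ := ∑ q ∈ S, ((quadRearrangements q).card : ℝ)
  have hfilter : ∀ q ∈ S, S.filter (· ∈ quadRearrangements q) = quadRearrangements q := by
    intro q hq
    obtain ⟨⟨i, j⟩, k⟩ := q
    obtain ⟨h1, h2⟩ := hS.mp hq
    dsimp only at h1 h2
    ext ⟨⟨i', j'⟩, k'⟩
    simp only [Finset.mem_filter, and_iff_right_iff_imp, hS, IsNontrivialQuad, quadRearrangements,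
      Finset.mem_product, Finset.mem_insert, Finset.mem_singleton, Prod.mk.injEq]
    have e1 : i + j - k ≠ i := fun e => h2 (by
      rw [sub_eq_iff_eq_add] at e; exact (add_left_cancel e).symm)
    have e2 : i + j - k ≠ j := fun e => h1 (by
      rw [sub_eq_iff_eq_add, add_comm i] at e; exact (add_left_cancel e).symm)
    rintro ⟨⟨rfl, rfl⟩ | ⟨rfl, rfl⟩, rfl | rfl⟩ <;> constructor <;> assumption
  have hD : ∫ a, (N ^ 2 * powerMean (spectralWeight a) 2 - t) ^ 2 ∂torusMeasure G = D := by
    have hsq : ∀ a : G → Circle, (((N ^ 2 * powerMean (spectralWeight a) 2 - t) ^ 2 : ℝ) : ℂ)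
        = ∑ q ∈ S, ∑ r ∈ S, quadMonomial a q * (starRingEnd ℂ) (quadMonomial a r) := fun a => by
      have h : ((N ^ 2 * powerMean (spectralWeight a) 2 - t : ℝ) : ℂ)
          = ∑ q ∈ S, quadMonomial a q := by
        rw [Complex.ofReal_sub, hX]; simp
      rw [← Finset.sum_mul_sum, ← map_sum, ← h, Complex.conj_ofReal, sq]
      push_cast; ring
    apply Complex.ofReal_injective
    rw [← integral_complex_ofReal]
    have hcc : ∀ q r, Continuous fun a : G → Circle =>
        quadMonomial a q * (starRingEnd ℂ) (quadMonomial a r) := fun q r =>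
      (continuous_quadMonomial q).mul (Complex.continuous_conj.comp (continuous_quadMonomial r))
    simp_rw [hsq]
    rw [integral_finsetSum _ fun q _ => integrable_finsetSum _ fun r _ =>
      integrable_of_continuous (hcc q r)]
    simp_rw [integral_finsetSum _ fun r _ => integrable_of_continuous (hcc _ r)]
    simp only [D]
    push_cast
    refine Finset.sum_congr rfl fun q hq => ?_
    rw [Finset.sum_congr rfl fun r hr => integral_quadMonomial_mul_conj (hS.mp hq) (hS.mp hr),
      Finset.sum_boole, hfilter q hq]
  refine ⟨D, ?_, ?_⟩
  · have hcardT : Fintype.card ((G × G) × G) = Fintype.card G ^ 3 := by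
      rw [Fintype.card_prod, Fintype.card_prod]; ring
    -- Each of the four degeneracies removes one degree of freedom, hence holds for at most `N²`
    -- quadruples. Outside `B` a quadruple is nontrivial with exactly four rearrangements.
    set B : Finset ((G × G) × G) := Finset.univ.filter fun q =>
      ((q.1.1 = q.1.2 ∨ q.2 = q.1.1) ∨ q.2 = q.1.2) ∨ q.2 = q.1.1 + q.1.2 - q.2
    have hB : B.card ≤ 4 * Fintype.card G ^ 2 := by
      have hcardP : Fintype.card (G × G) = Fintype.card G ^ 2 := by
        rw [Fintype.card_prod, sq]
      have c1 : (Finset.univ.filter fun q : (G × G) × G => q.1.1 = q.1.2).card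
          ≤ Fintype.card G ^ 2 := by
        rw [← hcardP, ← Finset.card_univ]
        refine Finset.card_le_card_of_injOn (fun q => (q.1.1, q.2)) (by simp) ?_
        rintro ⟨⟨i, j⟩, k⟩ h ⟨⟨i', j'⟩, k'⟩ h' e
        simp_all
      have c2 : (Finset.univ.filter fun q : (G × G) × G => q.2 = q.1.1).card
          ≤ Fintype.card G ^ 2 := by
        rw [← hcardP, ← Finset.card_univ]
        refine Finset.card_le_card_of_injOn (fun q => q.1) (by simp) ?_
        rintro ⟨⟨i, j⟩, k⟩ h ⟨⟨i', j'⟩, k'⟩ h' e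
        simp_all
      have c3 : (Finset.univ.filter fun q : (G × G) × G => q.2 = q.1.2).card
          ≤ Fintype.card G ^ 2 := by
        rw [← hcardP, ← Finset.card_univ]
        refine Finset.card_le_card_of_injOn (fun q => q.1) (by simp) ?_
        rintro ⟨⟨i, j⟩, k⟩ h ⟨⟨i', j'⟩, k'⟩ h' e
        simp_all
      have c4 : (Finset.univ.filter fun q : (G × G) × G => q.2 = q.1.1 + q.1.2 - q.2).card
          ≤ Fintype.card G ^ 2 := by
        rw [← hcardP, ← Finset.card_univ]
        refine Finset.card_le_card_of_injOn (fun q => (q.1.1, q.2)) (by simp) ?_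
        rintro ⟨⟨i, j⟩, k⟩ h ⟨⟨i', j'⟩, k'⟩ h' e
        simp only [Finset.coe_filter, Finset.mem_univ, true_and, Set.mem_ofPred_eq,
          Prod.mk.injEq] at h h' e
        obtain ⟨rfl, rfl⟩ := e
        rw [eq_sub_iff_add_eq] at h h'
        simp [add_left_cancel (h.symm.trans h')]
      simp only [B, Finset.filter_or]
      refine (Finset.card_union_le _ _).trans ?_
      have := (Finset.card_union_le (Finset.univ.filter (fun q : (G × G) × G => q.1.1 = q.1.2)
        ∪ Finset.univ.filter (fun q : (G × G) × G => q.2 = q.1.1))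
        (Finset.univ.filter (fun q : (G × G) × G => q.2 = q.1.2)))
      have := (Finset.card_union_le (Finset.univ.filter (fun q : (G × G) × G => q.1.1 = q.1.2))
        (Finset.univ.filter (fun q : (G × G) × G => q.2 = q.1.1)))
      omega
    have hBS : Bᶜ ⊆ S := by
      intro q hq
      simp only [B, Finset.mem_compl, Finset.mem_filter, Finset.mem_univ, true_and, not_or] at hq
      exact hS.mpr ⟨hq.1.1.2, hq.1.2⟩
    have upper : D ≤ 4 * N ^ 3 := by
      calc D ≤ ∑ q ∈ S, (4 : ℝ) := Finset.sum_le_sum fun q _ => by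
            exact_mod_cast card_quadRearrangements_le q
        _ = 4 * S.card := by rw [Finset.sum_const, nsmul_eq_mul, mul_comm]
        _ ≤ 4 * N ^ 3 := by
            have : (S.card : ℝ) ≤ (Fintype.card G ^ 3 : ℕ) := by
              rw [← hcardT]; exact_mod_cast Finset.card_le_univ S
            push_cast at this
            linarith
    have lower : 4 * N ^ 3 - 16 * N ^ 2 ≤ D := by
      calc 4 * N ^ 3 - 16 * N ^ 2 ≤ 4 * (Bᶜ.card : ℝ) := by
            have h1 := Finset.card_add_card_compl B
            rw [hcardT] at h1
            have h2 : (B.card : ℝ) + (Bᶜ.card : ℝ) = N ^ 3 := by simp only [N]; exact_mod_cast h1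
            have h3 : (B.card : ℝ) ≤ 4 * N ^ 2 := by simp only [N]; exact_mod_cast hB
            linarith
        _ = ∑ q ∈ Bᶜ, ((quadRearrangements q).card : ℝ) := by
            rw [mul_comm, ← nsmul_eq_mul, ← Finset.sum_const]
            refine Finset.sum_congr rfl fun q hq => ?_
            simp only [B, Finset.mem_compl, Finset.mem_filter, Finset.mem_univ, true_and,
              not_or] at hq
            rw [card_quadRearrangements hq.1.1.1 hq.2]
            norm_num
        _ ≤ D := Finset.sum_le_sum_of_subset_of_nonneg hBS fun _ _ _ => Nat.cast_nonneg _
    rw [abs_le]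
    constructor
    · linarith
    · nlinarith [sq_nonneg N]
  · have hexp : ∀ a : G → Circle, (N ^ 2 * powerMean (spectralWeight a) 2 - t) ^ 2
        = N ^ 4 * powerMean (spectralWeight a) 2 ^ 2
          - (2 * t * N ^ 2 * powerMean (spectralWeight a) 2 - t ^ 2) := fun a => by ring
    simp_rw [hexp] at hD
    rw [integral_sub (hint (by fun_prop)) (hint (by fun_prop)),
      integral_sub (hint (by fun_prop)) (hint (by fun_prop)), integral_const_mul,
      integral_const_mul, integral_powerMean_two, integral_const, probReal_univ, one_smul,
      ← ht] at hD
    linear_combination hD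

/-- The variance contributes `4 / N + O(1 / N²)`, cancelling the linear term of `(2 - 1/N)² = 4 -
4/N + 1/N²`. -/
theorem abs_integral_sq_powerMean_two_sub_le :
    |∫ a, powerMean (spectralWeight a) 2 ^ 2 ∂torusMeasure G - 4|
      ≤ 17 * ((Fintype.card G : ℝ)⁻¹) ^ 2 := by
  obtain ⟨D, hD, h⟩ := integral_sq_powerMean_two_sub (G := G)
  set N : ℝ := (Fintype.card G : ℝ)
  have hN : 0 < N := Nat.cast_pos.mpr Fintype.card_pos
  have h1 : ∫ a, powerMean (spectralWeight a) 2 ^ 2 ∂torusMeasure G - 4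
      = (N⁻¹) ^ 2 + (N⁻¹) ^ 4 * (D - 4 * N ^ 3) := by
    have h2 : ∫ a, powerMean (spectralWeight a) 2 ^ 2 ∂torusMeasure G
        = (2 - N⁻¹) ^ 2 + (N⁻¹) ^ 4 * D := by
      apply mul_left_cancel₀ (pow_ne_zero 4 hN.ne')
      rw [h]; field_simp
    rw [h2]; field_simp; ring
  rw [h1]
  refine (abs_add_le _ _).trans ?_
  rw [abs_of_nonneg (by positivity), abs_mul, abs_of_nonneg (by positivity)]
  calc _ ≤ (N⁻¹) ^ 2 + (N⁻¹) ^ 4 * (16 * N ^ 2) := by gcongr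
    _ = _ := by field_simp; ring

end Group

/-! ### The expansion of the moments of the glow -/

theorem cast_choose_three (p : ℕ) : (p.choose 3 : ℝ) = p * (p - 1) * (p - 2) / 6 := by
  have h := Nat.descFactorial_eq_factorial_mul_choose p 3
  have h' : (p.descFactorial 3 : ℝ) = p * (p - 1) * (p - 2) := by
    rcases p with _ | _ | p
    · simp
    · simp
    · simp [Nat.descFactorial_succ]; ring
  rw [← h', h]
  norm_num [Nat.factorial]

theorem exists_abs_integral_seriesMoment_sub_le (j : ℕ) (hj : j ≤ 4) (p : ℕ) :
    ∃ C : ℝ, ∀ (G : Type*) [AddCommGroup G] [Fintype G],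
      |∫ a, seriesMoment (spectralWeight a) p ∂torusMeasure G
        - ∫ a, truncatedExpansion (Fintype.card G : ℝ)⁻¹ (powerMean (spectralWeight a)) j p
          ∂torusMeasure G| ≤ C * ((Fintype.card G : ℝ)⁻¹) ^ j := by
  obtain ⟨C, hC0, hC⟩ := IsMomentRecursion.exists_abs_sub_truncatedExpansion_le p j hj
  refine ⟨C * p.factorial, fun G _ _ => ?_⟩
  have hy := continuous_powerMean_spectralWeight (G := G)
  have hT : Continuous fun a : G → Circle =>
      truncatedExpansion (Fintype.card G : ℝ)⁻¹ (powerMean (spectralWeight a)) j p := by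
    unfold truncatedExpansion
    refine continuous_finsetSum _ fun k _ => continuous_const.mul ?_
    rcases k with _ | _ | _ | _ | k <;> simp only [expansionCoeff] <;> fun_prop
  rw [← integral_sub (integrable_of_continuous (continuous_seriesMoment_spectralWeight p))
    (integrable_of_continuous hT)]
  refine abs_integral_le_integral_abs.trans ?_
  calc _ ≤ ∫ a, C * ((Fintype.card G : ℝ)⁻¹) ^ j * powerMean (spectralWeight a) p
        ∂torusMeasure G := by
        refine integral_mono (integrable_of_continuous
          ((continuous_seriesMoment_spectralWeight p).sub hT).abs)
          (integrable_of_continuous (continuous_const.mul (hy p))) fun a => ?_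
        exact hC _ _ _ (isMomentRecursion_spectralWeight a)
    _ = C * ((Fintype.card G : ℝ)⁻¹) ^ j * ∫ a, powerMean (spectralWeight a) p
        ∂torusMeasure G := integral_const_mul _ _
    _ ≤ C * ((Fintype.card G : ℝ)⁻¹) ^ j * p.factorial := by
        gcongr; exact integral_powerMean_le p
    _ = _ := by ring

theorem integral_truncatedExpansion_four (G : Type*) [AddCommGroup G] [Fintype G] (ε p : ℝ) :
    ∫ a, truncatedExpansion ε (powerMean (spectralWeight a)) 4 p ∂torusMeasure G
      = 1 - ε * (p * (p - 1) / 4 * ∫ a, powerMean (spectralWeight a) 2 ∂torusMeasure G)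
        + ε ^ 2 * (p * (p - 1) * (p - 2) / 9
            * ∫ a, powerMean (spectralWeight a) 3 ∂torusMeasure G
          + p * (p - 1) * (p - 2) * (p - 3) / 32
            * ∫ a, powerMean (spectralWeight a) 2 ^ 2 ∂torusMeasure G)
        - ε ^ 3 * (11 / 192 * (p * (p - 1) * (p - 2) * (p - 3))
            * ∫ a, powerMean (spectralWeight a) 4 ∂torusMeasure G
          + p * (p - 1) * (p - 2) * (p - 3) * (p - 4) / 36
            * ∫ a, powerMean (spectralWeight a) 2 * powerMean (spectralWeight a) 3 ∂torusMeasure G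
          + p * (p - 1) * (p - 2) * (p - 3) * (p - 4) * (p - 5) / 384
            * ∫ a, powerMean (spectralWeight a) 2 ^ 3 ∂torusMeasure G) := by
  have hy := continuous_powerMean_spectralWeight (G := G)
  have hint : ∀ {f : (G → Circle) → ℝ}, Continuous f → Integrable f (torusMeasure G) :=
    fun hf => integrable_of_continuous hf
  simp only [truncatedExpansion, Finset.sum_range_succ, Finset.sum_range_zero, zero_add,
    expansionCoeff]
  rw [integral_add (hint (by fun_prop)) (hint (by fun_prop)),
    integral_add (hint (by fun_prop)) (hint (by fun_prop)),
    integral_add (hint (by fun_prop)) (hint (by fun_prop)),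
    integral_const_mul, integral_const_mul, integral_const_mul, integral_const_mul, integral_neg,
    integral_neg,
    integral_add (hint (by fun_prop)) (hint (by fun_prop)),
    integral_add (hint (by fun_prop)) (hint (by fun_prop)),
    integral_add (hint (by fun_prop)) (hint (by fun_prop))]
  simp only [integral_const_mul, integral_const, probReal_univ, one_smul]
  ring

theorem exists_abs_glowMoment_sub_le (p : ℕ) : ∃ C : ℝ, ∀ (G : Type*) [AddCommGroup G] [Fintype G],
    |1 / (p.factorial : ℝ) * glowMoment G p
        - (1 - (p.choose 2 : ℝ) * (Fintype.card G : ℝ)⁻¹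
          + (p.choose 2 : ℝ) * ((3 * (p : ℝ) ^ 2 + p - 8) / 12) * ((Fintype.card G : ℝ)⁻¹) ^ 2
          - (p.choose 3 : ℝ) * (((p : ℝ) ^ 3 + 4 * (p : ℝ) ^ 2 + p - 18) / 8) *
              ((Fintype.card G : ℝ)⁻¹) ^ 3)|
      ≤ C * ((Fintype.card G : ℝ)⁻¹) ^ 4 := by
  obtain ⟨C₀, h₀⟩ := exists_abs_integral_seriesMoment_sub_le 4 le_rfl p
  obtain ⟨C₁, h₁⟩ := exists_abs_integral_powerMean_sub_le 4
  obtain ⟨C₂, h₂⟩ := exists_abs_integral_prod_powerMean_sub_le ![2, 3]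
  obtain ⟨C₃, h₃⟩ := exists_abs_integral_prod_powerMean_sub_le fun _ : Fin 3 => 2
  set q : ℝ := (p : ℝ)
  set A : ℝ := q * (q - 1) * (q - 2) / 9
  set B : ℝ := q * (q - 1) * (q - 2) * (q - 3) / 32
  set D : ℝ := 11 / 192 * (q * (q - 1) * (q - 2) * (q - 3))
  set E : ℝ := q * (q - 1) * (q - 2) * (q - 3) * (q - 4) / 36
  set F : ℝ := q * (q - 1) * (q - 2) * (q - 3) * (q - 4) * (q - 5) / 384
  refine ⟨C₀ + |A| * 4 + |B| * 17 + |D| * C₁ + |E| * C₂ + |F| * C₃, fun G _ _ => ?_⟩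
  specialize h₀ G
  specialize h₁ G
  specialize h₂ G
  specialize h₃ G
  have h₄ := abs_integral_sq_powerMean_two_sub_le (G := G)
  simp only [Fin.prod_univ_two, Matrix.cons_val_zero, Matrix.cons_val_one, Finset.prod_const,
    Finset.card_univ, Fintype.card_fin] at h₂ h₃
  have hp : (p.factorial : ℝ) ≠ 0 := by positivity
  have hε : 0 ≤ (Fintype.card G : ℝ)⁻¹ := by positivity
  rw [glowMoment_eq, one_div, inv_mul_cancel_left₀ hp, Nat.cast_choose_two, cast_choose_three]
  rw [integral_truncatedExpansion_four, integral_powerMean_two, integral_powerMean_three] at h₀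
  set ε : ℝ := (Fintype.card G : ℝ)⁻¹
  set I₀ := ∫ a, seriesMoment (spectralWeight a) p ∂torusMeasure G
  set I₁ := ∫ a, powerMean (spectralWeight a) 4 ∂torusMeasure G
  set I₂ := ∫ a, powerMean (spectralWeight a) 2 * powerMean (spectralWeight a) 3 ∂torusMeasure G
  set I₃ := ∫ a, powerMean (spectralWeight a) 2 ^ 3 ∂torusMeasure G
  set I₄ := ∫ a, powerMean (spectralWeight a) 2 ^ 2 ∂torusMeasure G
  have bound : ∀ {c x K : ℝ} (m n : ℕ), |x| ≤ K * ε ^ m → m + n = 4 →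
      |ε ^ n * (c * x)| ≤ |c| * K * ε ^ 4 := by
    intro c x K m n hx hmn
    rw [abs_mul, abs_mul, abs_of_nonneg (pow_nonneg hε n), ← hmn, pow_add]
    calc ε ^ n * (|c| * |x|) ≤ ε ^ n * (|c| * (K * ε ^ m)) := by gcongr
      _ = _ := by ring
  -- The limiting averages are `4! = 24`, `2! * 3! = 12` and `2!³ = 8`. Precision `O(ε)` is enough,
  -- as these terms carry `ε³`.
  have b₁ := bound (c := D) (x := I₁ - 24) 1 3 (by
    norm_num [Nat.factorial] at h₁ ⊢; exact h₁) rfl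
  have b₂ := bound (c := E) (x := I₂ - 12) 1 3 (by
    norm_num [Nat.factorial] at h₂ ⊢; exact h₂) rfl
  have b₃ := bound (c := F) (x := I₃ - 8) 1 3 (by
    norm_num [Nat.factorial] at h₃ ⊢; exact h₃) rfl
  have b₄ := bound (c := B) 2 2 h₄ rfl
  -- The `4 * ε ^ 2` in the exact average of `y 3` only matters at order four; its linear part `-9 *
  -- ε` enters the `ε³` coefficient.
  have b₅ := bound (c := A) (x := 4 * ε ^ 2) (K := 4) 2 2 (abs_of_nonneg (by positivity)).le rfl
  rw [abs_le] at *
  simp only [A, B, D, E, F] at *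
  constructor
  · linarith [h₀.1, b₁.1, b₁.2, b₂.1, b₂.2, b₃.1, b₃.2, b₄.1, b₄.2, b₅.1, b₅.2]
  · linarith [h₀.2, b₁.1, b₁.2, b₂.1, b₂.2, b₃.1, b₃.2, b₄.1, b₄.2, b₅.1, b₅.2]

theorem tendsto_integral_seriesMoment (G : ℕ → Type*) [∀ n, AddCommGroup (G n)]
    [∀ n, Fintype (G n)] (hG : Tendsto (fun n => Fintype.card (G n)) atTop atTop) (p : ℕ) :
    Tendsto (fun n => ∫ a, seriesMoment (spectralWeight a) p ∂torusMeasure (G n)) atTop (𝓝 1) := by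
  obtain ⟨C, hC⟩ := exists_abs_integral_seriesMoment_sub_le 1 (by norm_num) p
  rw [tendsto_iff_norm_sub_tendsto_zero]
  have h0 : Tendsto (fun n => C * (Fintype.card (G n) : ℝ)⁻¹) atTop (𝓝 0) := by
    simpa using (tendsto_inv_atTop_zero.comp
      (tendsto_natCast_atTop_atTop (R := ℝ) |>.comp hG)).const_mul C
  refine squeeze_zero (fun _ => norm_nonneg _) (fun n => ?_) h0
  simpa [truncatedExpansion, expansionCoeff] using hC (G n)

theorem integral_seriesMoment_mem_Icc (G : Type*) [AddCommGroup G] [Fintype G] (p : ℕ) :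
    ∫ a, seriesMoment (spectralWeight a) p ∂torusMeasure G ∈ Set.Icc (0 : ℝ) 1 := by
  have h : ∀ a : G → Circle, 0 ≤ seriesMoment (spectralWeight a) p
      ∧ seriesMoment (spectralWeight a) p ≤ 1 := fun a =>
    seriesMoment_nonneg_le_one (spectralWeight_nonneg a) (sum_spectralWeight a) p
  refine ⟨integral_nonneg fun a => (h a).1, ?_⟩
  refine (integral_mono (integrable_of_continuous (continuous_seriesMoment_spectralWeight p))
    (integrable_const (1 : ℝ)) fun a => (h a).2).trans_eq ?_
  simp

/-! ### The complex Gaussian law -/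

theorem integral_complexGaussian {f : ℂ → ℂ} (hf : Continuous f) :
    ∫ z, f z ∂complexGaussian
      = (Real.pi : ℂ)⁻¹ * ∫ z : ℂ, f z * (Real.exp (-‖z‖ ^ 2) : ℂ) := by
  have hs2 : (Real.sqrt 2 : ℂ) ≠ 0 := by
    exact_mod_cast (Real.sqrt_pos.mpr (by norm_num : (0 : ℝ) < 2)).ne'
  have hsq : Real.sqrt 2 ^ 2 = 2 := Real.sq_sqrt (by norm_num)
  rw [complexGaussian, integral_map (by fun_prop) hf.aestronglyMeasurable,
    gaussianReal_of_var_ne_zero _ one_ne_zero,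
    prod_withDensity (by fun_prop) (by fun_prop),
    integral_withDensity_eq_integral_toReal_smul (by fun_prop)
      (ae_of_all _ fun _ => ENNReal.mul_lt_top gaussianPDF_lt_top gaussianPDF_lt_top)]
  -- Scaling the plane by `√2` has Jacobian two, which turns the constant `1 / (2π)` into `1 / π`.
  have hR : ∫ z : ℂ, f ((Real.sqrt 2)⁻¹ • z) * (Real.exp (-‖(Real.sqrt 2)⁻¹ • z‖ ^ 2) : ℂ)
      = 2 * ∫ z : ℂ, f z * (Real.exp (-‖z‖ ^ 2) : ℂ) := by
    rw [Measure.integral_comp_smul volume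
      (fun z : ℂ => f z * (Real.exp (-‖z‖ ^ 2) : ℂ)), Complex.finrank_real_complex, inv_pow, hsq,
      inv_inv, abs_of_pos (by norm_num : (0 : ℝ) < 2), Complex.real_smul]
    push_cast
    rfl
  have hE := Complex.volume_preserving_equiv_real_prod.symm.integral_comp'
    (fun z : ℂ => f ((Real.sqrt 2)⁻¹ • z) * (Real.exp (-‖(Real.sqrt 2)⁻¹ • z‖ ^ 2) : ℂ))
  rw [hR] at hE
  have hpi : (Real.pi : ℂ) ≠ 0 := by exact_mod_cast Real.pi_ne_zero
  have : ∀ I : ℂ, (Real.pi : ℂ)⁻¹ * I = (2 * Real.pi : ℂ)⁻¹ * (2 * I) := fun I => by field_simp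
  rw [this, ← hE, ← integral_const_mul]
  refine integral_congr_ae (ae_of_all _ fun xy => ?_)
  obtain ⟨x, y⟩ := xy
  have hz : Complex.measurableEquivRealProd.symm (x, y) = (x : ℂ) + Complex.I * y := by
    apply Complex.ext <;> simp [Complex.measurableEquivRealProd]
  have hz' : ((Real.sqrt 2)⁻¹ • ((x : ℂ) + Complex.I * y))
      = ((x : ℂ) + Complex.I * y) / (Real.sqrt 2 : ℂ) := by
    rw [Complex.real_smul, div_eq_inv_mul]; push_cast; rfl
  have hnorm : ‖((x : ℂ) + Complex.I * y) / (Real.sqrt 2 : ℂ)‖ ^ 2 = (x ^ 2 + y ^ 2) / 2 := by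
    rw [norm_div, div_pow, ← Complex.normSq_eq_norm_sq, ← Complex.normSq_eq_norm_sq,
      Complex.normSq_ofReal, ← sq, hsq, Complex.normSq_apply]
    simp
    ring
  have hs : (Real.sqrt (2 * Real.pi))⁻¹ * (Real.sqrt (2 * Real.pi))⁻¹ = (2 * Real.pi)⁻¹ := by
    rw [← mul_inv, Real.mul_self_sqrt (by positivity)]
  have hexp : gaussianPDFReal 0 1 x * gaussianPDFReal 0 1 y
      = (2 * Real.pi)⁻¹ * Real.exp (-((x ^ 2 + y ^ 2) / 2)) := by
    rw [← hs]
    simp only [gaussianPDFReal, NNReal.coe_one, mul_one, sub_zero]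
    rw [mul_mul_mul_comm, ← Real.exp_add]
    congr 2
    ring
  dsimp only
  rw [hz, hz', hnorm, ENNReal.toReal_mul, toReal_gaussianPDF, toReal_gaussianPDF, hexp,
    Complex.real_smul]
  push_cast
  ring

theorem integral_complexGaussian_pow (k l : ℕ) :
    ∫ z, z ^ k * (starRingEnd ℂ) z ^ l ∂complexGaussian
      = if k = l then (k.factorial : ℂ) else 0 := by
  rw [integral_complexGaussian (by
    exact (continuous_id.pow k).mul (Complex.continuous_conj.pow l))]
  split_ifs with hkl
  · subst hkl
    have h : ∀ z : ℂ, z ^ k * (starRingEnd ℂ) z ^ k * (Real.exp (-‖z‖ ^ 2) : ℂ)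
        = ((‖z‖ ^ ((2 * k : ℕ) : ℝ) * Real.exp (-‖z‖ ^ (2 : ℝ)) : ℝ) : ℂ) := fun z => by
      rw [← norm_pow_two_mul_eq, Real.rpow_natCast, Real.rpow_two]; push_cast; rfl
    simp_rw [h]
    rw [integral_complex_ofReal, Complex.integral_rpow_mul_exp_neg_rpow (by norm_num)
      (by have : (0 : ℝ) ≤ ((2 * k : ℕ) : ℝ) := Nat.cast_nonneg _
          linarith)]
    have hg : (((2 * k : ℕ) : ℝ) + 2) / 2 = (k : ℝ) + 1 := by push_cast; ring
    have hpi : (Real.pi : ℂ) ≠ 0 := by exact_mod_cast Real.pi_ne_zero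
    rw [hg, Real.Gamma_nat_eq_factorial]
    push_cast
    field_simp
  · obtain ⟨w, hw⟩ := exists_circle_zpow_eq_neg_one (m := (k : ℤ) - l)
      (sub_ne_zero.mpr (by exact_mod_cast hkl))
    rw [← circle_pow_mul_conj_pow] at hw
    have h := (rotation w).measurePreserving.integral_comp
      (rotation w).toHomeomorph.measurableEmbedding
      (fun z : ℂ => z ^ k * (starRingEnd ℂ) z ^ l * (Real.exp (-‖z‖ ^ 2) : ℂ))
    have h' : ∀ z : ℂ, (rotation w z) ^ k * (starRingEnd ℂ) (rotation w z) ^ l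
        * (Real.exp (-‖rotation w z‖ ^ 2) : ℂ)
        = -(z ^ k * (starRingEnd ℂ) z ^ l * (Real.exp (-‖z‖ ^ 2) : ℂ)) := fun z => by
      rw [LinearIsometryEquiv.norm_map, rotation_apply, map_mul, mul_pow, mul_pow,
        mul_mul_mul_comm, hw]
      ring
    simp_rw [h', integral_neg] at h
    rw [self_eq_neg.mp h.symm, mul_zero]

theorem charFun_complexGaussian (t : ℂ) :
    charFun complexGaussian t = Complex.exp (-(‖t‖ ^ 2 / 4 : ℝ)) := by
  have hsq : (Real.sqrt 2 : ℝ) ^ 2 = 2 := Real.sq_sqrt (by norm_num)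
  rw [charFun_apply, complexGaussian, integral_map (by fun_prop)
    (by fun_prop : Continuous fun z : ℂ => Complex.exp (inner ℝ z t * Complex.I)).aestronglyMeasurable]
  have h : ∀ xy : ℝ × ℝ, Complex.exp (inner ℝ (((xy.1 : ℂ) + Complex.I * (xy.2 : ℂ))
      / (Real.sqrt 2 : ℂ)) t * Complex.I)
      = Complex.exp ((t.re / Real.sqrt 2 : ℝ) * xy.1 * Complex.I)
        * Complex.exp ((t.im / Real.sqrt 2 : ℝ) * xy.2 * Complex.I) := fun xy => by
    rw [← Complex.exp_add, ← add_mul]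
    congr 2
    rw [Complex.inner, ← Complex.ofReal_mul, ← Complex.ofReal_mul, ← Complex.ofReal_add]
    congr 1
    rw [map_div₀, Complex.conj_ofReal, ← mul_div_assoc, Complex.div_ofReal_re]
    simp
    ring
  simp_rw [h]
  rw [integral_prod_mul (fun x : ℝ => Complex.exp ((t.re / Real.sqrt 2 : ℝ) * x * Complex.I))
    (fun y : ℝ => Complex.exp ((t.im / Real.sqrt 2 : ℝ) * y * Complex.I)), ← charFun_apply_real,
    ← charFun_apply_real, charFun_gaussianReal, charFun_gaussianReal, ← Complex.exp_add]
  congr 1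
  have : ‖t‖ ^ 2 = t.re ^ 2 + t.im ^ 2 := by
    rw [← Complex.normSq_eq_norm_sq, Complex.normSq_apply]; ring
  rw [this]
  have e : ∀ x : ℝ, (((x / Real.sqrt 2 : ℝ) : ℂ)) ^ 2 = ((x ^ 2 / 2 : ℝ) : ℂ) := fun x => by
    rw [← Complex.ofReal_pow, div_pow, hsq]
  simp only [e]
  push_cast
  ring

/-! ### Convergence in distribution -/

section Group

variable {G : Type*} [AddCommGroup G] [Fintype G]

theorem integral_inner_rescaledExcess_pow (t : ℂ) (m : ℕ) :
    ∫ ab, ((inner ℝ (rescaledExcess G ab) t : ℝ) : ℂ) ^ m ∂uniformPhases G (AddChar G ℂ)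
      = ∑ k ∈ Finset.range (m + 1), ((starRingEnd ℂ) t ^ k * t ^ (m - k) * m.choose k / 2 ^ m)
        * if k = m - k then
            ((k.factorial * ∫ a, seriesMoment (spectralWeight a) k ∂torusMeasure G : ℝ) : ℂ)
          else 0 := by
  have h : ∀ z : ℂ, ((inner ℝ z t : ℝ) : ℂ) ^ m
      = ∑ k ∈ Finset.range (m + 1), ((starRingEnd ℂ) t ^ k * t ^ (m - k) * m.choose k / 2 ^ m)
        * (z ^ k * (starRingEnd ℂ) z ^ (m - k)) := fun z => by
    have h1 : ((inner ℝ z t : ℝ) : ℂ)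
        = (z * (starRingEnd ℂ) t + (starRingEnd ℂ) z * t) / 2 := by
      rw [Complex.inner, Complex.re_eq_add_conj, map_mul, Complex.conj_conj]; ring
    rw [h1, div_pow, add_pow, Finset.sum_div]
    refine Finset.sum_congr rfl fun k _ => ?_
    rw [mul_pow, mul_pow]; ring
  have hc : ∀ k l : ℕ, Continuous fun ab => rescaledExcess G ab ^ k
      * (starRingEnd ℂ) (rescaledExcess G ab) ^ l := fun k l =>
    (continuous_rescaledExcess.pow k).mul
      ((Complex.continuous_conj.comp continuous_rescaledExcess).pow l)
  simp_rw [h]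
  rw [integral_finsetSum _ fun k _ => (integrable_of_continuous (hc _ _)).const_mul _]
  simp_rw [integral_const_mul, integral_rescaledExcess_pow]

theorem integral_inner_rescaledExcess_pow_odd (t : ℂ) {m : ℕ} (hm : ¬ Even m) :
    ∫ ab, ((inner ℝ (rescaledExcess G ab) t : ℝ) : ℂ) ^ m ∂uniformPhases G (AddChar G ℂ) = 0 := by
  rw [integral_inner_rescaledExcess_pow]
  refine Finset.sum_eq_zero fun k hk => ?_
  rw [if_neg, mul_zero]
  intro h
  have := Finset.mem_range.mp hk
  exact hm ⟨k, by omega⟩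

theorem integral_inner_rescaledExcess_pow_even (t : ℂ) (p : ℕ) :
    ∫ ab, ((inner ℝ (rescaledExcess G ab) t : ℝ) : ℂ) ^ (2 * p) ∂uniformPhases G (AddChar G ℂ)
      = (((‖t‖ ^ 2 / 4) ^ p * (2 * p).choose p * p.factorial
        * ∫ a, seriesMoment (spectralWeight a) p ∂torusMeasure G : ℝ) : ℂ) := by
  rw [integral_inner_rescaledExcess_pow, Finset.sum_eq_single p]
  · rw [show 2 * p - p = p by omega, if_pos rfl, ← mul_pow, mul_comm _ t, Complex.mul_conj,
      Complex.normSq_eq_norm_sq, pow_mul]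
    push_cast
    rw [div_pow]
    norm_num
    ring
  · intro k hk hkp
    rw [if_neg, mul_zero]
    have := Finset.mem_range.mp hk
    omega
  · intro h
    exact absurd (Finset.mem_range.mpr (by omega)) h

/-- For a fixed group the excess is bounded, so the exponential may be integrated term by term. Odd
moments vanish, and the factorials in the even ones combine to `1 / p!`. -/
theorem hasSum_charFun_rescaledExcess (t : ℂ) :
    HasSum (fun p : ℕ => (((-(‖t‖ ^ 2 / 4)) ^ p / p.factorial
        * ∫ a, seriesMoment (spectralWeight a) p ∂torusMeasure G : ℝ) : ℂ))
      (charFun ((uniformPhases G (AddChar G ℂ)).map (rescaledExcess G)) t) := by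
  have hcont : Continuous fun ab => (inner ℝ (rescaledExcess G ab) t : ℝ) :=
    continuous_rescaledExcess.inner continuous_const
  obtain ⟨B, hB⟩ := isCompact_univ.exists_bound_of_continuousOn hcont.continuousOn
  have hsum : HasSum (fun m : ℕ => ∫ ab, (((inner ℝ (rescaledExcess G ab) t : ℝ) : ℂ)
      * Complex.I) ^ m / m.factorial ∂uniformPhases G (AddChar G ℂ))
      (∫ ab, Complex.exp ((inner ℝ (rescaledExcess G ab) t : ℝ) * Complex.I)
        ∂uniformPhases G (AddChar G ℂ)) := by
    refine hasSum_integral_of_dominated_convergence (fun m _ => B ^ m / m.factorial)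
      (fun m => ?_) (fun m => ae_of_all _ fun ab => ?_)
      (ae_of_all _ fun _ => Real.summable_pow_div_factorial B) (integrable_const _)
      (ae_of_all _ fun ab => ?_)
    · exact ((((Complex.continuous_ofReal.comp hcont).mul continuous_const).pow m).div_const
        _).aestronglyMeasurable
    · rw [norm_div, norm_pow, norm_mul, Complex.norm_I, mul_one, Complex.norm_natCast,
        Complex.norm_real]
      gcongr
      exact hB ab trivial
    · rw [Complex.exp_eq_exp_ℂ]
      exact NormedSpace.expSeries_div_hasSum_exp _
  rw [charFun_apply, integral_map continuous_rescaledExcess.aemeasurable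
    (by fun_prop : Continuous fun z : ℂ => Complex.exp (inner ℝ z t * Complex.I)).aestronglyMeasurable]
  have hinj : Function.Injective fun p : ℕ => 2 * p := mul_right_injective₀ two_ne_zero
  rw [← hinj.hasSum_iff] at hsum
  · convert hsum using 1
    funext p
    simp only [Function.comp_apply, mul_pow]
    rw [integral_div, integral_mul_const, integral_inner_rescaledExcess_pow_even, pow_mul Complex.I,
      Complex.I_sq]
    have hf : ((2 * p).factorial : ℂ) = (2 * p).choose p * p.factorial * p.factorial := by
      have := Nat.add_choose_mul_factorial_mul_factorial p p
      rw [← two_mul] at this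
      exact_mod_cast this.symm
    have h1 : (p.factorial : ℂ) ≠ 0 := by exact_mod_cast p.factorial_ne_zero
    have h2 : (((2 * p).choose p : ℕ) : ℂ) ≠ 0 := by
      exact_mod_cast (Nat.choose_pos (by omega)).ne'
    rw [hf, neg_pow]
    push_cast
    field_simp
  · intro m hm
    have hm' : ¬ Even m := fun ⟨p, hp⟩ => hm ⟨p, by simp only; omega⟩
    simp only [mul_pow]
    rw [integral_div, integral_mul_const, integral_inner_rescaledExcess_pow_odd t hm', zero_mul,
      zero_div]

end Group

/-- Each averaged `seriesMoment` tends to one and stays in `[0, 1]`, so the exponential series of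
`‖t‖² / 4` dominates uniformly in `n`. -/
theorem tendsto_charFun_rescaledExcess (G : ℕ → Type*) [∀ n, AddCommGroup (G n)]
    [∀ n, Fintype (G n)] (hG : Tendsto (fun n => Fintype.card (G n)) atTop atTop) (t : ℂ) :
    Tendsto (fun n => charFun ((uniformPhases (G n) (AddChar (G n) ℂ)).map (rescaledExcess (G n))) t)
      atTop (𝓝 (charFun complexGaussian t)) := by
  have hlim : charFun complexGaussian t
      = ∑' p : ℕ, (((-(‖t‖ ^ 2 / 4)) ^ p / p.factorial * 1 : ℝ) : ℂ) := by
    rw [charFun_complexGaussian, ← Complex.ofReal_tsum, ← Complex.ofReal_neg, ← Complex.ofReal_exp,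
      Real.exp_eq_exp_ℝ]
    simp_rw [mul_one]
    rw [(NormedSpace.expSeries_div_hasSum_exp (-(‖t‖ ^ 2 / 4))).tsum_eq]
  rw [hlim]
  simp_rw [fun n => (hasSum_charFun_rescaledExcess (G := G n) t).tsum_eq.symm]
  refine tendsto_tsum_of_dominated_convergence (Real.summable_pow_div_factorial (‖t‖ ^ 2 / 4))
    (fun p => ?_) (Eventually.of_forall fun n p => ?_)
  · exact (Complex.continuous_ofReal.tendsto _).comp
      ((tendsto_integral_seriesMoment G hG p).const_mul _)
  · obtain ⟨h0, h1⟩ := integral_seriesMoment_mem_Icc (G n) p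
    rw [Complex.norm_real, norm_mul, norm_div, norm_pow, norm_neg, Real.norm_of_nonneg h0,
      Real.norm_of_nonneg (by positivity : (0 : ℝ) ≤ ‖t‖ ^ 2 / 4), Real.norm_natCast]
    exact mul_le_of_le_one_right (by positivity) h1

theorem tendstoInDistribution_rescaledExcess (G : ℕ → Type*) [∀ n, AddCommGroup (G n)]
    [∀ n, Fintype (G n)] (hG : Tendsto (fun n => Fintype.card (G n)) atTop atTop) :
    TendstoInDistribution (fun n => rescaledExcess (G n)) atTop (id : ℂ → ℂ)
      (fun n => uniformPhases (G n) (AddChar (G n) ℂ)) complexGaussian where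
  forall_aemeasurable n := continuous_rescaledExcess.aemeasurable
  aemeasurable_limit := aemeasurable_id
  tendsto := by
    refine ProbabilityMeasure.tendsto_of_tendsto_charFun fun t => ?_
    simpa using tendsto_charFun_rescaledExcess G hG t

theorem tendsto_integral_rescaledExcess_pow (G : ℕ → Type*) [∀ n, AddCommGroup (G n)]
    [∀ n, Fintype (G n)] (hG : Tendsto (fun n => Fintype.card (G n)) atTop atTop) (k l : ℕ) :
    Tendsto (fun n => ∫ ab, rescaledExcess (G n) ab ^ k
        * (starRingEnd ℂ) (rescaledExcess (G n) ab) ^ l ∂uniformPhases (G n) (AddChar (G n) ℂ))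
      atTop (𝓝 (∫ z, z ^ k * (starRingEnd ℂ) z ^ l ∂complexGaussian)) := by
  simp_rw [integral_rescaledExcess_pow, integral_complexGaussian_pow]
  split_ifs with hkl
  · have h := (Complex.continuous_ofReal.tendsto _).comp
      ((tendsto_integral_seriesMoment G hG k).const_mul (k.factorial : ℝ))
    simpa [Function.comp_def] using h
  · exact tendsto_const_nhds

end FourierGlow

/-! ### Assembly, with universality from the uniform expansion -/

theorem theorem11p19 :
    -- the moment expansion, with an error that is uniform over all finite abelian groups
    (∀ p : ℕ, ∃ C : ℝ, ∀ (G : Type*) [AddCommGroup G] [Fintype G],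
      |1 / (p.factorial : ℝ) * FourierGlow.glowMoment G p
          - (1 - (p.choose 2 : ℝ) * (Fintype.card G : ℝ)⁻¹
            + (p.choose 2 : ℝ) * ((3 * (p : ℝ) ^ 2 + p - 8) / 12) * ((Fintype.card G : ℝ)⁻¹) ^ 2
            - (p.choose 3 : ℝ) * (((p : ℝ) ^ 3 + 4 * (p : ℝ) ^ 2 + p - 18) / 8) *
                ((Fintype.card G : ℝ)⁻¹) ^ 3)|
        ≤ C * ((Fintype.card G : ℝ)⁻¹) ^ 4) ∧
    -- universality up to order 3: groups of the same order have the same moments up to `O(N⁻⁴)`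
    (∀ p : ℕ, ∃ C : ℝ, ∀ (G G' : Type*) [AddCommGroup G] [Fintype G] [AddCommGroup G']
      [Fintype G'], Fintype.card G = Fintype.card G' →
        |1 / (p.factorial : ℝ) * FourierGlow.glowMoment G p
            - 1 / (p.factorial : ℝ) * FourierGlow.glowMoment G' p|
          ≤ C * ((Fintype.card G : ℝ)⁻¹) ^ 4) ∧
    -- the rescaled glow is asymptotically complex Gaussian, in distribution and in moments
    (∀ (G : ℕ → Type*) [∀ n, AddCommGroup (G n)] [∀ n, Fintype (G n)],
      Tendsto (fun n => Fintype.card (G n)) atTop atTop →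
        TendstoInDistribution (fun n => FourierGlow.rescaledExcess (G n)) atTop
          (id : ℂ → ℂ) (fun n => FourierGlow.uniformPhases (G n) (AddChar (G n) ℂ))
          FourierGlow.complexGaussian ∧
        ∀ k l : ℕ, Tendsto
          (fun n => ∫ ab, FourierGlow.rescaledExcess (G n) ab ^ k *
              (starRingEnd ℂ) (FourierGlow.rescaledExcess (G n) ab) ^ l
            ∂(FourierGlow.uniformPhases (G n) (AddChar (G n) ℂ))) atTop
          (𝓝 (∫ z, z ^ k * (starRingEnd ℂ) z ^ l ∂FourierGlow.complexGaussian))) := by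
  refine ⟨FourierGlow.exists_abs_glowMoment_sub_le, fun p => ?_, fun G _ _ hG =>
    ⟨FourierGlow.tendstoInDistribution_rescaledExcess G hG,
      FourierGlow.tendsto_integral_rescaledExcess_pow G hG⟩⟩
  obtain ⟨C, hC⟩ := FourierGlow.exists_abs_glowMoment_sub_le p
  -- Each constant covers the groups of one universe; drawing two lets `G` and `G'` live in
  -- different ones.
  obtain ⟨C', hC'⟩ := FourierGlow.exists_abs_glowMoment_sub_le p
  refine ⟨C + C', fun G G' _ _ _ _ hcard => ?_⟩
  have h := hC G
  have h' := hC' G'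
  rw [← hcard] at h'
  rw [abs_sub_comm] at h'
  refine (abs_sub_le _ _ _).trans ((add_le_add h h').trans_eq ?_)
  ring
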